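/- All manifolds are finite-dimensional and smooth. Let $G$ be a Lie group acting smoothly on the left on a manifold $Q$ so that $\pi:Q\to Q/G$ is a principal $G$-bundle, and let $(Q,L_d,\mathcal D_d,\mathcal D^{nh})$ be a discrete nonholonomic mechanical system: $L_d:Q\times Q\to\mathbb R$ is smooth, $\mathcal D_d\subset Q\times Q$ is a regular submanifold and $\mathcal D^{nh}\subset TQ$ is a subbundle. Assume that $L_d$ and $\mathcal D_d$ are invariant under the diagonal $G$-action and $\mathcal D^{nh}$ under the lifted action. Let $\mathcal A_d$ be an affine discrete connection on $\pi$: a $G$-invariant submanifold $Hor\subset Q\times Q$ that contains $\{(q,\gamma(q)q):q\in Q\}$ for a smooth $\gamma:Q\to G$ with $\gamma(gq)=g\gamma(q)g^{-1}$, and on which $\mathrm{id}\times\pi$ is an injective local diffeomorphism to $Q\times (Q/G)$. Let $\mathfrak U=\{(q_0,gq_1):(q_0,q_1)\in Hor,\ g\in G\}$ be its domain and, for $(q_0,q_1)\in\mathfrak U$, let $\mathcal A_d(q_0,q_1)$ be the unique $g\in G$ with $(q_0,g^{-1}q_1)\in Hor$. Let $\tilde G=(Q\times G)/G$, with $G$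 acting on $G$ by conjugation, let $\phi:\tilde G\to Q/G$, $\phi([q,w])=\pi(q)$, and let $$\Upsilon:\mathfrak U\to\tilde G\times (Q/G),\qquad \Upsilon(q_0,q_1)=([q_0,\mathcal A_d(q_0,q_1)],\pi(q_1)),\qquad \check{\mathfrak U}=\Upsilon(\mathfrak U).$$ The associated reduced discrete Lagrange--D'Alembert--Poincaré system $\mathcal M=(\tilde G,\check L_d,\check{\mathcal D}_d,\check{\mathcal D},\check{\mathcal P})$ is given by $\check L_d(\Upsilon(q_0,q_1))=L_d(q_0,q_1)$; $\check{\mathcal D}_d=\Upsilon(\mathcal D_d\cap\mathfrak U)$; $\check{\mathcal D}_{\Upsilon(q_0,q_1)}=\{d\Upsilon(q_0,q_1)(v,0):v\in\mathcal D^{nh}_{q_0}\}$, which consists of vectors of the form $(w,0)$; and, for $x=\Upsilon(q_0,q_1)$ and $y=\Upsilon(q_1,q_2)$, the linear map $\check{\mathcal P}(x,y):\check{\mathcal D}_{y}\to\ker d\phi$ with $$\check{\mathcal P}(x,y)\big(d\Upsilon(q_1,q_2)(\delta q_1,0)\big)=D_2(p_1\circ\Upsilon)(q_0,q_1)(\delta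 q_1),\qquad \delta q_1\in\mathcal D^{nh}_{q_1}.$$ A discrete path of $\mathcal M$ is a sequence $x_k=(v_k,r_{k+1})\in\check{\mathfrak U}$, $k=0,\dots,N-1$, $N\ge 1$, with $r_k=\phi(v_k)$ for $1\le k\le N-1$. A nonholonomic infinitesimal variation with fixed endpoints on it is a family $(\delta v_k,\delta r_{k+1})\in T_{x_k}(\tilde G\times (Q/G))$ with $\delta r_k=d\phi(v_k)(\delta v_k)$ for $1\le k\le N-1$, $\delta r_N=0$, and, for some $(w_k,0)\in\check{\mathcal D}_{x_k}$ with $w_0=0$, $\delta v_{N-1}=w_{N-1}$ and $\delta v_k=w_k+\check{\mathcal P}(x_k,x_{k+1})(w_{k+1},0)$ for $0\le k\le N-2$. The path is a trajectory of $\mathcal M$ if all $x_k\in\check{\mathcal D}_d$ and $d\check S_d$ vanishes on all these variations, where $\check S_d(x_\cdot)=\sum_k\check L_d(x_k)$. A fixed-endpoint variation in $\mathcal D^{nh}$ on $q_\cdot=(q_0,\dots,q_N)$ is a family $\delta q_k\in\mathcal D^{nh}_{q_k}$ with $\delta q_0=0$ and $\delta q_N=0$. Then $\check{\mathfrak U}$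 is open, $\check L_d$, $\check{\mathcal D}$ and $\check{\mathcal P}$ are well defined, $\check L_d$ is smooth, and the following hold for every $N\ge1$. 1. Let $q_\cdot=(q_0,\dots,q_N)$ satisfy $(q_k,q_{k+1})\in\mathfrak U$ for all $k$, and put $x_k=(v_k,r_{k+1})=\Upsilon(q_k,q_{k+1})$. Then $x_\cdot$ is a discrete path of $\mathcal M$, and for every fixed-endpoint variation $\delta q_\cdot$ in $\mathcal D^{nh}$ on $q_\cdot$, the family $$(\delta v_k,\delta r_{k+1})=d\Upsilon(q_k,q_{k+1})(\delta q_k,\delta q_{k+1}),\qquad k=0,\dots,N-1,\tag{$*$}$$ is a nonholonomic infinitesimal variation on $x_\cdot$ with fixed endpoints. 2. Conversely, for $q_\cdot$ and $x_\cdot$ as in 1, every nonholonomic infinitesimal variation on $x_\cdot$ with fixed endpoints is given by $(*)$ for some fixed-endpoint variation $\delta q_\cdot$ in $\mathcal D^{nh}$ on $q_\cdot$. 3. Hence, for $q_\cdot$ and $x_\cdot$ as in 1, $x_\cdot$ is a trajectory of $\mathcal M$ if and only if all $x_k\in\check{\mathcal D}_d$ and $d\check S_d(x_\cdot)$ vanishes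 on all variations $(*)$ with $\delta q_\cdot$ a fixed-endpoint variation in $\mathcal D^{nh}$ on $q_\cdot$. Consequently a sequence in $\tilde G\times(Q/G)$ is a trajectory of $\mathcal M$ if and only if it is a trajectory of the reduced system of Fernández--Tori--Zuccalli, that is, of the form $x_k=\Upsilon(q_k,q_{k+1})$ for some $q_\cdot$ as in 1 for which this variational principle holds. -/

import Mathlib

open scoped Manifold ContDiff Topology

noncomputable section

namespace DiscreteReduction

/-! ### Submanifolds, subbundles, tangent vectors to products -/

section General

variable {V : Type*} [NormedAddCommGroup V] [NormedSpace ℝ V]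
  {H : Type*} [TopologicalSpace H] (I : ModelWithCorners ℝ V H)
  {X : Type*} [TopologicalSpace X] [ChartedSpace H X]
  {V' : Type*} [NormedAddCommGroup V'] [NormedSpace ℝ V']
  {H' : Type*} [TopologicalSpace H'] (J : ModelWithCorners ℝ V' H')
  {Y : Type*} [TopologicalSpace Y] [ChartedSpace H' Y]

/-- A regular (embedded) submanifold: around each of its points there is a slice chart, that is, a
smooth chart in which the set is cut out by a linear subspace of the model space. -/
def IsRegularSubmanifold (S : Set X) : Prop :=
  ∀ z ∈ S, ∃ (Φ : PartialDiffeomorph I 𝓘(ℝ, V) X V ∞) (F : Submodule ℝ V),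
    z ∈ Φ.source ∧ ∀ y ∈ Φ.source, (y ∈ S ↔ Φ y ∈ F)

/-- For a regular submanifold `S` of `X` and a smooth map `f : X → Y`: the restriction `f|_S` is a
local diffeomorphism from `S` to `Y`. (A map into `S` is smooth if and only if it is smooth as a map
into `X`.) -/
def IsLocalDiffeoOnSubmanifold (f : X → Y) (S : Set X) : Prop :=
  ∀ z ∈ S, ∃ (W : Set X) (O : Set Y) (σ : Y → X),
    IsOpen W ∧ z ∈ W ∧ IsOpen O ∧ ContMDiffOn J I ∞ σ O ∧
    Set.MapsTo f (S ∩ W) O ∧ Set.MapsTo σ O (S ∩ W) ∧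
    Set.LeftInvOn σ f (S ∩ W) ∧ Set.RightInvOn σ f O

/-- A family of subspaces of the tangent spaces is a smooth subbundle of the tangent bundle: it has
smooth local frames. -/
def IsTangentSubbundle [IsManifold I ∞ X] (D : ∀ q : X, Submodule ℝ (TangentSpace I q)) : Prop :=
  ∀ q₀ : X, ∃ (U : Set X) (n : ℕ) (s : Fin n → ∀ q : X, TangentSpace I q),
    IsOpen U ∧ q₀ ∈ U ∧
    (∀ i, ContMDiffOn I I.tangent ∞ (fun q => (⟨q, s i q⟩ : TangentBundle I X)) U) ∧
    ∀ q ∈ U, LinearIndependent ℝ (fun i => s i q) ∧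
      Submodule.span ℝ (Set.range fun i => s i q) = D q

variable {I J}

/-- The tangent vector `(a, b) ∈ T_{(x,y)}(X × Y)` with `a ∈ T_x X`, `b ∈ T_y Y`. -/
def tpair {z : X × Y} (a : TangentSpace I z.1) (b : TangentSpace J z.2) :
    TangentSpace (I.prod J) z :=
  ((a, b) : V × V')

/-- The `X`-component of a tangent vector to `X × Y`. -/
def tfst {z : X × Y} (w : TangentSpace (I.prod J) z) : TangentSpace I z.1 :=
  Prod.fst (show V × V' from w)

/-- The `Y`-component of a tangent vector to `X × Y`. -/
def tsnd {z : X × Y} (w : TangentSpace (I.prod J) z) : TangentSpace J z.2 :=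
  Prod.snd (show V × V' from w)

end General

/-! ### Discrete Lagrange--D'Alembert--Poincaré systems -/

section DLDPS

variable {V : Type*} [NormedAddCommGroup V] [NormedSpace ℝ V]
  {H : Type*} [TopologicalSpace H] (I : ModelWithCorners ℝ V H)
  {E : Type*} [TopologicalSpace E] [ChartedSpace H E]
  {V' : Type*} [NormedAddCommGroup V'] [NormedSpace ℝ V']
  {H' : Type*} [TopologicalSpace H'] (J : ModelWithCorners ℝ V' H')
  {M : Type*} [TopologicalSpace M] [ChartedSpace H' M]

/-- The data `(E, L_d, 𝒟_d, 𝒟, 𝒫)` of a discrete Lagrange--D'Alembert--Poincaré system over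
`φ : E → M`. As the discrete Lagrangian and the other data may be given only on an open subset of
`C'(E) = E × M`, this subset is recorded as `dom` (it is everything for a globally defined system);
values outside `dom` play no role.

The fiber of `p₁^*(TE)` at `(ε, m)`, which consists of the vectors `(δε, 0)`, is identified with
`T_ε E`. -/
structure DLDPSData (φ : E → M) where
  /-- the part of `C'(E)` where the system lives -/
  dom : Set (E × M)
  /-- the discrete Lagrangian -/
  L : E × M → ℝ
  /-- the kinematic constraints -/
  Dd : Set (E × M)
  /-- the variational constraints, a family of subspaces of the fibers of `p₁^*(TE)` -/
  D : ∀ y : E × M, Submodule ℝ (TangentSpace I y.1)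
  /-- the nonholonomic infinitesimal variation chaining map: at
  `(x, y) = ((ε₀, m₁), (ε₁, m₂)) ∈ C''(E)` it is a linear map from `𝒟_{(ε₁, m₂)}` to
  `ker dφ(ε₀)` -/
  P : ∀ x y : E × M, D y →ₗ[ℝ] LinearMap.ker (mfderiv I J φ x.1).toLinearMap

variable {I J} {φ : E → M} (S : DLDPSData I J φ) {N : ℕ}

namespace DLDPSData

/-- `x = ((ε₀, m₁), …, (ε_{N-1}, m_N))` is a discrete path: `m_{k+1} = φ(ε_{k+1})`. -/
def IsPath (x : Fin N → E × M) : Prop :=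
  (∀ k, x k ∈ S.dom) ∧
  ∀ (k : ℕ) (hk : k + 1 < N), (x ⟨k, Nat.lt_of_succ_lt hk⟩).2 = φ (x ⟨k + 1, hk⟩).1

/-- `δ_k = (δε_k, δm_{k+1})`, `k = 0, …, N-1`, is an infinitesimal variation over the path `x`:
`δm_{k+1} = dφ(ε_{k+1})(δε_{k+1})` for `k + 1 = 1, …, N - 1`. -/
def IsVariation (x : Fin N → E × M) (δ : ∀ k, TangentSpace (I.prod J) (x k)) : Prop :=
  ∀ (k : ℕ) (hk : k + 1 < N),
    (⟨(x ⟨k, Nat.lt_of_succ_lt hk⟩).2, tsnd (δ ⟨k, Nat.lt_of_succ_lt hk⟩)⟩ : TangentBundle J M) =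
      ⟨φ (x ⟨k + 1, hk⟩).1, mfderiv I J φ (x ⟨k + 1, hk⟩).1 (tfst (δ ⟨k + 1, hk⟩))⟩

/-- Nonholonomic infinitesimal variations with fixed endpoints. The vectors `w_k ∈ 𝒟_{x_k}`,
`k = 1, …, N - 1`, are arbitrary; with `w_0 := 0` the conditions are
`δm_N = 0`, `δε_{N-1} = w_{N-1}`, and `δε_k = w_k + 𝒫(x_k, x_{k+1})(w_{k+1})` for
`k = 0, …, N - 2`. -/
def IsNHVariation (x : Fin N → E × M) (δ : ∀ k, TangentSpace (I.prod J) (x k)) : Prop :=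
  IsVariation (φ := φ) x δ ∧
  ∃ w : ∀ k, S.D (x k),
    (∀ k : Fin N, (k : ℕ) = 0 → w k = 0) ∧
    (∀ k : Fin N, (k : ℕ) + 1 = N → tsnd (δ k) = 0 ∧ tfst (δ k) = (w k : TangentSpace I (x k).1)) ∧
    ∀ (k : ℕ) (hk : k + 1 < N),
      tfst (δ ⟨k, Nat.lt_of_succ_lt hk⟩) = (w ⟨k, Nat.lt_of_succ_lt hk⟩ : TangentSpace I (x ⟨k, Nat.lt_of_succ_lt hk⟩).1) +
        (S.P (x ⟨k, Nat.lt_of_succ_lt hk⟩) (x ⟨k + 1, hk⟩) (w ⟨k + 1, hk⟩) :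
          TangentSpace I (x ⟨k, Nat.lt_of_succ_lt hk⟩).1)

/-- The discrete action `S_d : C'(E)^N → ℝ`. -/
def action (x : Fin N → E × M) : ℝ := ∑ k, S.L (x k)

/-- The differential `dS_d(x)(δ)` of the discrete action. -/
def dAction (x : Fin N → E × M) (δ : ∀ k, TangentSpace (I.prod J) (x k)) : ℝ :=
  mfderiv (ModelWithCorners.pi fun _ : Fin N => I.prod J) 𝓘(ℝ, ℝ) S.action x
    (show TangentSpace (ModelWithCorners.pi fun _ : Fin N => I.prod J) x from
      (fun k => δ k : Fin N → V × V'))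

/-- Trajectories. -/
def IsTrajectory (x : Fin N → E × M) : Prop :=
  S.IsPath x ∧ (∀ k, x k ∈ S.Dd) ∧
  ∀ δ : ∀ k, TangentSpace (I.prod J) (x k), S.IsNHVariation x δ → S.dAction x δ = 0

end DLDPSData

end DLDPS

/-! ### Principal bundles and the conjugate bundle -/

section Bundle

/-- The orbit space `Q/G`, with the quotient topology. -/
abbrev OrbitSpace (G Q : Type*) [Group G] [MulAction G Q] : Type _ :=
  MulAction.orbitRel.Quotient G Q

/-- The quotient map `π^{Q,G} : Q → Q/G`. -/
def orbitMk (G : Type*) {Q : Type*} [Group G] [MulAction G Q] (q : Q) : OrbitSpace G Q :=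
  Quotient.mk _ q

/-- The manifold `Q × G`, with `G` acting on `Q` by the given action and on `G` by conjugation. -/
def ConjProd (G Q : Type*) : Type _ := Q × G

instance (G Q : Type*) [TopologicalSpace G] [TopologicalSpace Q] :
    TopologicalSpace (ConjProd G Q) :=
  inferInstanceAs (TopologicalSpace (Q × G))

instance (G Q : Type*) [Group G] [MulAction G Q] : MulAction G (ConjProd G Q) where
  smul g z := (g • z.1, g * z.2 * g⁻¹)
  one_smul z := Prod.ext (one_smul G z.1) (show 1 * z.2 * (1 : G)⁻¹ = z.2 by simp)
  mul_smul g g' z := Prod.ext (mul_smul g g' z.1)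
    (show g * g' * z.2 * (g * g')⁻¹ = g * (g' * z.2 * g'⁻¹) * g⁻¹ by simp [mul_assoc])

variable (EG EQ EB : Type*)
  [NormedAddCommGroup EG] [NormedSpace ℝ EG] [NormedAddCommGroup EQ] [NormedSpace ℝ EQ]
  [NormedAddCommGroup EB] [NormedSpace ℝ EB]
  (G Q : Type*) [Group G] [TopologicalSpace G] [ChartedSpace EG G]
  [TopologicalSpace Q] [ChartedSpace EQ Q] [MulAction G Q]
  [ChartedSpace EB (OrbitSpace G Q)]

variable {EG EQ EB G Q} in
/-- `Φ` is a smooth equivariant trivialization `π⁻¹(U) ≃ U × G` of `Q → Q/G` over `U`, where `G`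
acts on `U × G` by left translations of the second factor. -/
structure IsTrivialization
    (Φ : PartialDiffeomorph 𝓘(ℝ, EQ) (𝓘(ℝ, EB).prod 𝓘(ℝ, EG)) Q (OrbitSpace G Q × G) ∞)
    (U : Set (OrbitSpace G Q)) : Prop where
  source_eq : Φ.source = orbitMk G ⁻¹' U
  target_eq : Φ.target = U ×ˢ Set.univ
  fst_eq : ∀ q ∈ Φ.source, (Φ q).1 = orbitMk G q
  equivariant : ∀ q ∈ Φ.source, ∀ g : G, (Φ (g • q)).2 = g * (Φ q).2

/-- The smooth left action of `G` on `Q` makes `π^{Q,G} : Q → Q/G` a principal `G`-bundle, for the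
given manifold structure on `Q/G`. -/
structure IsPrincipalBundle : Prop where
  smooth_action : ContMDiffSMul 𝓘(ℝ, EG) 𝓘(ℝ, EQ) ∞ G Q
  exists_trivialization : ∀ b : OrbitSpace G Q, ∃ (U : Set (OrbitSpace G Q))
    (Φ : PartialDiffeomorph 𝓘(ℝ, EQ) (𝓘(ℝ, EB).prod 𝓘(ℝ, EG)) Q (OrbitSpace G Q × G) ∞),
    b ∈ U ∧ IsTrivialization Φ U

variable {EG EQ EB G Q}

/-- The total space `G̃ = (Q × G)/G` of the conjugate bundle, with the quotient topology. -/
@[nolint unusedArguments]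
def ConjBundle (_h : IsPrincipalBundle EG EQ EB G Q) : Type _ :=
  OrbitSpace G (ConjProd G Q)

variable (h : IsPrincipalBundle EG EQ EB G Q)

instance : TopologicalSpace (ConjBundle h) :=
  inferInstanceAs (TopologicalSpace (OrbitSpace G (ConjProd G Q)))

/-- The quotient map `π^{Q×G,G} : Q × G → G̃`. -/
def conjMk (q : Q) (w : G) : ConjBundle h :=
  orbitMk G (show ConjProd G Q from (q, w))

/-- The projection `p^{Q/G} : G̃ → Q/G`. -/
def conjProj : ConjBundle h → OrbitSpace G Q :=
  Quotient.lift (fun z : ConjProd G Q => orbitMk G z.1) (by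
    rintro z z' ⟨g, rfl⟩
    exact Quotient.sound ⟨g, rfl⟩)

open Classical in
/-- The map `G̃|_U → U × G`, `[q, w] ↦ (π(q), a(q)⁻¹ w a(q))`, defined by a trivialization
`q ↦ (π(q), a(q))` of `Q` over `U`. -/
def conjTrivFun {h : IsPrincipalBundle EG EQ EB G Q}
    {Φ : PartialDiffeomorph 𝓘(ℝ, EQ) (𝓘(ℝ, EB).prod 𝓘(ℝ, EG)) Q (OrbitSpace G Q × G) ∞}
    {U : Set (OrbitSpace G Q)} (hΦ : IsTrivialization Φ U) :
    ConjBundle h → OrbitSpace G Q × G :=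
  Quotient.lift (fun z : ConjProd G Q => (orbitMk G z.1,
      if orbitMk G z.1 ∈ U then (Φ z.1).2⁻¹ * z.2 * (Φ z.1).2 else 1)) (by
    rintro z z' ⟨g, rfl⟩
    have h1 : (orbitMk G (g • z').1 : OrbitSpace G Q) = orbitMk G z'.1 := Quotient.sound ⟨g, rfl⟩
    refine Prod.ext h1 ?_
    simp only [h1]
    split_ifs with hU
    · have h2 : (Φ (g • z').1).2 = g * (Φ z'.1).2 :=
        hΦ.equivariant z'.1 (by rw [hΦ.source_eq]; exact hU) g
      have h3 : (g • z').2 = g * z'.2 * g⁻¹ := rfl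
      rw [h2, h3]
      group
    · rfl)

theorem conjTrivFun_mk {h : IsPrincipalBundle EG EQ EB G Q}
    {Φ : PartialDiffeomorph 𝓘(ℝ, EQ) (𝓘(ℝ, EB).prod 𝓘(ℝ, EG)) Q (OrbitSpace G Q × G) ∞}
    {U : Set (OrbitSpace G Q)} (hΦ : IsTrivialization Φ U) {q : Q} (hq : orbitMk G q ∈ U) (w : G) :
    conjTrivFun hΦ (conjMk h q w) = (orbitMk G q, (Φ q).2⁻¹ * w * (Φ q).2) :=
  Prod.ext rfl (if_pos hq)

theorem exists_conjMk (z : ConjBundle h) : ∃ (q : Q) (w : G), conjMk h q w = z := by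
  obtain ⟨⟨q, w⟩, rfl⟩ := Quotient.exists_rep z
  exact ⟨q, w, rfl⟩

theorem conjMk_smul (g : G) (q : Q) (w : G) :
    conjMk h (g • q) (g * w * g⁻¹) = conjMk h q w :=
  Quotient.sound ⟨g, rfl⟩

theorem conjMk_continuous : Continuous fun z : Q × G => conjMk h z.1 z.2 :=
  continuous_quotient_mk' (s := MulAction.orbitRel G (ConjProd G Q))

theorem conjProj_continuous : Continuous (conjProj h) :=
  Continuous.quotient_lift (f := fun z : ConjProd G Q => orbitMk G z.1)
    (continuous_quotient_mk'.comp (continuous_fst (X := Q) (Y := G))) _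

namespace IsTrivialization

variable {Φ : PartialDiffeomorph 𝓘(ℝ, EQ) (𝓘(ℝ, EB).prod 𝓘(ℝ, EG)) Q (OrbitSpace G Q × G) ∞}
  {U : Set (OrbitSpace G Q)}

theorem isOpen_base (hΦ : IsTrivialization Φ U) : IsOpen U := by
  have h1 : IsOpen (orbitMk G ⁻¹' U) := hΦ.source_eq ▸ Φ.open_source
  exact h1

theorem inv_mem (hΦ : IsTrivialization Φ U) {b : OrbitSpace G Q} (hb : b ∈ U) (u : G) :
    Φ.invFun (b, u) ∈ Φ.source :=
  Φ.map_target' (by rw [hΦ.target_eq]; exact ⟨hb, trivial⟩)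

theorem apply_inv (hΦ : IsTrivialization Φ U) {b : OrbitSpace G Q} (hb : b ∈ U) (u : G) :
    Φ (Φ.invFun (b, u)) = (b, u) :=
  Φ.right_inv' (by rw [hΦ.target_eq]; exact ⟨hb, trivial⟩)

theorem mk_inv (hΦ : IsTrivialization Φ U) {b : OrbitSpace G Q} (hb : b ∈ U) (u : G) :
    orbitMk G (Φ.invFun (b, u)) = b := by
  rw [← hΦ.fst_eq _ (hΦ.inv_mem hb u), hΦ.apply_inv hb u]

theorem smul_inv (hΦ : IsTrivialization Φ U) {q : Q} (hq : orbitMk G q ∈ U) :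
    (Φ q).2 • Φ.invFun (orbitMk G q, 1) = q := by
  have hq' : q ∈ Φ.source := by rw [hΦ.source_eq]; exact hq
  have hs := hΦ.inv_mem hq 1
  have h0 : (orbitMk G ((Φ q).2 • Φ.invFun (orbitMk G q, 1)) : OrbitSpace G Q) = orbitMk G q :=
    (Quotient.sound ⟨_, rfl⟩ : _ = orbitMk G (Φ.invFun (orbitMk G q, 1))).trans (hΦ.mk_inv hq 1)
  have hs' : (Φ q).2 • Φ.invFun (orbitMk G q, 1) ∈ Φ.source := by
    rw [hΦ.source_eq]; change orbitMk G _ ∈ U; rw [h0]; exact hq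
  refine Φ.toPartialEquiv.injOn hs' hq' (Prod.ext ?_ ?_)
  · exact (hΦ.fst_eq _ hs').trans (h0.trans (hΦ.fst_eq _ hq').symm)
  · refine (hΦ.equivariant _ hs _).trans ?_
    rw [hΦ.apply_inv hq 1, mul_one]

end IsTrivialization

variable [LieGroup 𝓘(ℝ, EG) ∞ G]

theorem conjMk_isOpenMap : IsOpenMap fun z : Q × G => conjMk h z.1 z.2 := by
  have : IsTopologicalGroup G := topologicalGroup_of_lieGroup 𝓘(ℝ, EG) ∞
  have hs := h.smooth_action.contMDiff_smul.continuous
  have : ContinuousConstSMul G (ConjProd G Q) := ⟨fun g => by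
    have h1 : Continuous fun z : Q × G => (g • z.1, g * z.2 * g⁻¹) :=
      (hs.comp (Continuous.prodMk continuous_const continuous_fst)).prodMk (by fun_prop)
    exact h1⟩
  exact isOpenMap_quotient_mk'_mul (Γ := G) (T := ConjProd G Q)

/-- The local trivialization `G̃|_U ≃ U × G` of the conjugate bundle defined by a trivialization
of `Q` over `U`. -/
def conjTriv
    {Φ : PartialDiffeomorph 𝓘(ℝ, EQ) (𝓘(ℝ, EB).prod 𝓘(ℝ, EG)) Q (OrbitSpace G Q × G) ∞}
    {U : Set (OrbitSpace G Q)} (hΦ : IsTrivialization Φ U) :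
    OpenPartialHomeomorph (ConjBundle h) (OrbitSpace G Q × G) where
  toFun := conjTrivFun hΦ
  invFun p := conjMk h (Φ.invFun (p.1, 1)) p.2
  source := conjProj h ⁻¹' U
  target := U ×ˢ Set.univ
  map_source' z hz := by
    obtain ⟨q, w, rfl⟩ := exists_conjMk h z
    exact ⟨hz, trivial⟩
  map_target' p hp := by
    change orbitMk G (Φ.invFun (p.1, 1)) ∈ U
    rw [hΦ.mk_inv hp.1 1]
    exact hp.1
  left_inv' z hz := by
    obtain ⟨q, w, rfl⟩ := exists_conjMk h z
    have hz' : orbitMk G q ∈ U := hz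
    rw [conjTrivFun_mk hΦ hz']
    have h1 := hΦ.smul_inv hz'
    conv_rhs => rw [← conjMk_smul h (Φ q).2⁻¹ q w, inv_inv]
    congr 1
    rw [eq_inv_smul_iff]
    exact h1
  right_inv' p hp := by
    have h1 := hΦ.mk_inv hp.1 1
    rw [conjTrivFun_mk hΦ (by rw [h1]; exact hp.1), h1, hΦ.apply_inv hp.1 1]
    simp
  open_source := hΦ.isOpen_base.preimage (conjProj_continuous h)
  open_target := hΦ.isOpen_base.prod isOpen_univ
  continuousOn_toFun := by
    have : IsTopologicalGroup G := topologicalGroup_of_lieGroup 𝓘(ℝ, EG) ∞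
    intro z hz
    obtain ⟨q, w, rfl⟩ := exists_conjMk h z
    have hq : q ∈ Φ.source := by rw [hΦ.source_eq]; exact hz
    refine ContinuousAt.continuousWithinAt ?_
    refine Filter.Tendsto.mono_left ?_ ((conjMk_isOpenMap h).nhds_le (q, w))
    rw [Filter.tendsto_map'_iff]
    have hsrc : ∀ᶠ y : Q × G in 𝓝 (q, w), y.1 ∈ Φ.source :=
      (Φ.open_source.preimage continuous_fst).mem_nhds hq
    have hΦc : ContinuousAt (fun y : Q × G => Φ y.1) (q, w) :=
      ContinuousAt.comp (f := Prod.fst) (g := Φ)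
        (Φ.contMDiffOn_toFun.continuousOn.continuousAt (Φ.open_source.mem_nhds hq))
        continuous_fst.continuousAt
    have hF : ContinuousAt
        (fun y : Q × G => ((Φ y.1).1, (Φ y.1).2⁻¹ * y.2 * (Φ y.1).2)) (q, w) :=
      hΦc.fst.prodMk ((hΦc.snd.inv.mul continuous_snd.continuousAt).mul hΦc.snd)
    have heq : (fun y : Q × G => ((Φ y.1).1, (Φ y.1).2⁻¹ * y.2 * (Φ y.1).2)) =ᶠ[𝓝 (q, w)]
        (fun y : Q × G => conjTrivFun (h := h) hΦ (conjMk h y.1 y.2)) := by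
      filter_upwards [hsrc] with y hy
      have hy' : orbitMk G y.1 ∈ U := by rw [hΦ.source_eq] at hy; exact hy
      rw [conjTrivFun_mk hΦ hy', hΦ.fst_eq _ hy]
    exact hF.congr heq
  continuousOn_invFun := by
    refine (conjMk_continuous h).comp_continuousOn (ContinuousOn.prodMk ?_ continuousOn_snd)
    refine Φ.contMDiffOn_invFun.continuousOn.comp (Continuous.continuousOn (by fun_prop)) ?_
    intro p hp
    rw [hΦ.target_eq]
    exact ⟨hp.1, trivial⟩

/-- The smooth atlas of `G̃`: the charts are the compositions of the local trivializations
`G̃|_U ≃ U × G` with charts of `(Q/G) × G`. -/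
instance conjBundleChartedSpace : ChartedSpace (ModelProd EB EG) (ConjBundle h) where
  atlas := {c | ∃ (U : Set (OrbitSpace G Q))
    (Φ : PartialDiffeomorph 𝓘(ℝ, EQ) (𝓘(ℝ, EB).prod 𝓘(ℝ, EG)) Q (OrbitSpace G Q × G) ∞)
    (hΦ : IsTrivialization Φ U),
    ∃ e ∈ atlas (ModelProd EB EG) (OrbitSpace G Q × G), c = conjTriv h hΦ ≫ₕ e}
  chartAt z :=
    let hΦ := (h.exists_trivialization (conjProj h z)).choose_spec.choose_spec.2
    conjTriv h hΦ ≫ₕ chartAt (ModelProd EB EG) (conjTriv h hΦ z)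
  mem_chart_source z := by
    have hU := (h.exists_trivialization (conjProj h z)).choose_spec.choose_spec.1
    rw [OpenPartialHomeomorph.trans_source]
    exact ⟨hU, mem_chart_source (ModelProd EB EG) (conjTriv h _ z)⟩
  chart_mem_atlas z := ⟨_, _, _, _, chart_mem_atlas _ _, rfl⟩

theorem conjTriv_transition
    {Φ Φ' : PartialDiffeomorph 𝓘(ℝ, EQ) (𝓘(ℝ, EB).prod 𝓘(ℝ, EG)) Q (OrbitSpace G Q × G) ∞}
    {U U' : Set (OrbitSpace G Q)} (hΦ : IsTrivialization Φ U) (hΦ' : IsTrivialization Φ' U') :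
    ContMDiffOn (𝓘(ℝ, EB).prod 𝓘(ℝ, EG)) (𝓘(ℝ, EB).prod 𝓘(ℝ, EG)) ∞
      (fun p => conjTriv h hΦ' ((conjTriv h hΦ).symm p)) ((U ∩ U') ×ˢ Set.univ) := by
  have hs : ContMDiffOn (𝓘(ℝ, EB).prod 𝓘(ℝ, EG)) (𝓘(ℝ, EB).prod 𝓘(ℝ, EG)) ∞
      (fun p : OrbitSpace G Q × G => Φ' (Φ.invFun (p.1, 1))) ((U ∩ U') ×ˢ Set.univ) := by
    refine Φ'.contMDiffOn_toFun.comp (t := Φ'.source) (Φ.contMDiffOn_invFun.comp (t := Φ.target)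
      (contMDiff_fst.prodMk contMDiff_const).contMDiffOn ?_) ?_
    · intro p hp
      rw [hΦ.target_eq]
      exact ⟨hp.1.1, trivial⟩
    · intro p hp
      rw [hΦ'.source_eq]
      change orbitMk G _ ∈ U'
      rw [hΦ.mk_inv hp.1.1 1]
      exact hp.1.2
  have ha := contMDiff_snd.comp_contMDiffOn hs
  have hF : ContMDiffOn (𝓘(ℝ, EB).prod 𝓘(ℝ, EG)) (𝓘(ℝ, EB).prod 𝓘(ℝ, EG)) ∞
      (fun p : OrbitSpace G Q × G => (p.1, (Φ' (Φ.invFun (p.1, 1))).2⁻¹ * p.2 *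
        (Φ' (Φ.invFun (p.1, 1))).2)) ((U ∩ U') ×ˢ Set.univ) :=
    contMDiff_fst.contMDiffOn.prodMk ((ha.inv.mul contMDiff_snd.contMDiffOn).mul ha)
  refine hF.congr fun p hp => ?_
  have h1 := hΦ.mk_inv hp.1.1 1
  refine (conjTrivFun_mk (h := h) hΦ' (q := Φ.invFun (p.1, 1)) (by rw [h1]; exact hp.1.2) p.2).trans ?_
  rw [h1]

/-- `G̃` is a smooth manifold. -/
instance conjBundleIsManifold [IsManifold 𝓘(ℝ, EB) ∞ (OrbitSpace G Q)] :
    IsManifold (𝓘(ℝ, EB).prod 𝓘(ℝ, EG)) ∞ (ConjBundle h) := by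
  refine isManifold_of_contDiffOn _ _ _ ?_
  rintro c c' ⟨U, Φ, hΦ, e, he, rfl⟩ ⟨U', Φ', hΦ', e', he', rfl⟩
  have hc : ContMDiffOn (𝓘(ℝ, EB).prod 𝓘(ℝ, EG)) (𝓘(ℝ, EB).prod 𝓘(ℝ, EG)) ∞
      ((conjTriv h hΦ ≫ₕ e).symm ≫ₕ (conjTriv h hΦ' ≫ₕ e'))
      ((conjTriv h hΦ ≫ₕ e).symm ≫ₕ (conjTriv h hΦ' ≫ₕ e')).source := by
    have h1 := contMDiffOn_symm_of_mem_maximalAtlas (I := 𝓘(ℝ, EB).prod 𝓘(ℝ, EG)) (n := ∞)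
      (IsManifold.subset_maximalAtlas he)
    have h2 := contMDiffOn_of_mem_maximalAtlas (I := 𝓘(ℝ, EB).prod 𝓘(ℝ, EG)) (n := ∞)
      (IsManifold.subset_maximalAtlas he')
    refine h2.comp (t := e'.source) (((conjTriv_transition h hΦ hΦ').comp
      (t := (U ∩ U') ×ˢ Set.univ) (h1.mono ?_) ?_)) ?_
    · intro x hx
      simp only [mfld_simps] at hx
      exact hx.1.1
    · intro x hx
      simp only [mfld_simps] at hx
      have h3 : e.symm x ∈ U ×ˢ (Set.univ : Set G) := hx.1.2
      have h4 : orbitMk G (Φ.invFun ((e.symm x).1, 1)) ∈ U' := hx.2.1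
      rw [hΦ.mk_inv h3.1] at h4
      exact ⟨⟨h3.1, h4⟩, trivial⟩
    · intro x hx
      simp only [mfld_simps] at hx
      exact hx.2.2
  have hd := (contMDiffOn_iff.1 hc).2 ((0, 0) : EB × EG) ((0, 0) : EB × EG)
  refine hd.mono ?_
  intro x hx
  exact ⟨⟨by rw [ModelWithCorners.target_eq]; exact hx.2, trivial⟩, hx.1,
    ⟨trivial, by rw [ModelWithCorners.source_eq]; trivial⟩⟩

end Bundle

/-! ### Discrete connections -/

section Connection

variable {EG EQ EB : Type*}
  [NormedAddCommGroup EG] [NormedSpace ℝ EG] [NormedAddCommGroup EQ] [NormedSpace ℝ EQ]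
  [NormedAddCommGroup EB] [NormedSpace ℝ EB]
  {G Q : Type*} [Group G] [TopologicalSpace G] [ChartedSpace EG G]
  [TopologicalSpace Q] [ChartedSpace EQ Q] [MulAction G Q]
  [ChartedSpace EB (OrbitSpace G Q)]

/-- An affine discrete connection on the principal bundle `Q → Q/G`. -/
@[nolint unusedArguments]
structure DiscreteConnection (_h : IsPrincipalBundle EG EQ EB G Q) where
  /-- the level of the connection -/
  level : Q → G
  /-- the horizontal submanifold -/
  Hor : Set (Q × Q)
  level_smooth : ContMDiff 𝓘(ℝ, EQ) 𝓘(ℝ, EG) ∞ level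
  level_equivariant : ∀ (g : G) (q : Q), level (g • q) = g * level q * g⁻¹
  submanifold : IsRegularSubmanifold (𝓘(ℝ, EQ).prod 𝓘(ℝ, EQ)) Hor
  invariant : ∀ (g : G) (q₀ q₁ : Q), (q₀, q₁) ∈ Hor → (g • q₀, g • q₁) ∈ Hor
  graph_subset : ∀ q : Q, (q, level q • q) ∈ Hor
  injOn : Set.InjOn (fun z : Q × Q => (z.1, orbitMk G z.2)) Hor
  localDiffeo : IsLocalDiffeoOnSubmanifold (𝓘(ℝ, EQ).prod 𝓘(ℝ, EQ)) (𝓘(ℝ, EQ).prod 𝓘(ℝ, EB))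
    (fun z : Q × Q => (z.1, orbitMk G z.2)) Hor

namespace DiscreteConnection

variable {h : IsPrincipalBundle EG EQ EB G Q} (A : DiscreteConnection h)

/-- The domain `𝔘 = {(q₀, g q₁) : (q₀, q₁) ∈ Hor, g ∈ G}` of the discrete connection. -/
def domain : Set (Q × Q) :=
  {z | ∃ (q₁ : Q) (g : G), (z.1, q₁) ∈ A.Hor ∧ z.2 = g • q₁}

open Classical in
/-- The discrete connection form: for `(q₀, q₁) ∈ 𝔘`, the unique `g ∈ G` with
`(q₀, g⁻¹ q₁) ∈ Hor`. -/
def form (z : Q × Q) : G :=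
  if hz : ∃ g : G, (z.1, g⁻¹ • z.2) ∈ A.Hor then hz.choose else 1

/-- The map `Υ(q₀, q₁) = (π^{Q×G,G}(q₀, 𝒜_d(q₀, q₁)), π^{Q,G}(q₁))` from `Q × Q` to
`G̃ × (Q/G)`, meaningful on `𝔘`. -/
def Upsilon (z : Q × Q) : ConjBundle h × OrbitSpace G Q :=
  (conjMk h z.1 (A.form z), orbitMk G z.2)

end DiscreteConnection

end Connection

/-! ### Symmetric discrete nonholonomic mechanical systems and their reduction -/

section Mechanics

variable {EQ : Type*} [NormedAddCommGroup EQ] [NormedSpace ℝ EQ]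
  (Q : Type*) [TopologicalSpace Q] [ChartedSpace EQ Q] [IsManifold 𝓘(ℝ, EQ) ∞ Q]

variable (EQ) in
/-- A discrete nonholonomic mechanical system `(Q, L_d, 𝒟_d, 𝒟^{nh})`. -/
structure DNHMS where
  /-- the discrete Lagrangian -/
  L : Q × Q → ℝ
  /-- the kinematic constraints -/
  Dd : Set (Q × Q)
  /-- the variational constraints `𝒟^{nh} ⊆ TQ` -/
  D : ∀ q : Q, Submodule ℝ (TangentSpace 𝓘(ℝ, EQ) q)
  L_smooth : ContMDiff (𝓘(ℝ, EQ).prod 𝓘(ℝ, EQ)) 𝓘(ℝ, ℝ) ∞ L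
  Dd_submanifold : IsRegularSubmanifold (𝓘(ℝ, EQ).prod 𝓘(ℝ, EQ)) Dd
  D_subbundle : IsTangentSubbundle 𝓘(ℝ, EQ) D

variable {Q}

/-- `L_d` and `𝒟_d` are invariant by the diagonal action and `𝒟^{nh}` is invariant by the lifted
action of `G` on `TQ`. -/
structure DNHMS.IsInvariant (S : DNHMS EQ Q) (G : Type*) [Group G] [MulAction G Q] : Prop where
  L_inv : ∀ (g : G) (q₀ q₁ : Q), S.L (g • q₀, g • q₁) = S.L (q₀, q₁)
  Dd_inv : ∀ (g : G) (q₀ q₁ : Q), (q₀, q₁) ∈ S.Dd → (g • q₀, g • q₁) ∈ S.Dd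
  D_inv : ∀ (g : G) (q : Q), ∀ v ∈ S.D q,
    mfderiv 𝓘(ℝ, EQ) 𝓘(ℝ, EQ) (fun q' : Q => g • q') q v ∈ S.D (g • q)

/-- A fixed-endpoint variation `δq` in `𝒟^{nh}` on the discrete path `q = (q_0, …, q_N)`. -/
def DNHMS.IsFixedEndpointVariation (S : DNHMS EQ Q) {N : ℕ} (q : Fin (N + 1) → Q)
    (δq : ∀ k, TangentSpace 𝓘(ℝ, EQ) (q k)) : Prop :=
  δq 0 = 0 ∧ δq (Fin.last N) = 0 ∧ ∀ k, δq k ∈ S.D (q k)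

variable {EG EB : Type*} [NormedAddCommGroup EG] [NormedSpace ℝ EG]
  [NormedAddCommGroup EB] [NormedSpace ℝ EB]
  {G : Type*} [Group G] [TopologicalSpace G] [ChartedSpace EG G] [LieGroup 𝓘(ℝ, EG) ∞ G]
  [MulAction G Q] [ChartedSpace EB (OrbitSpace G Q)]
  {h : IsPrincipalBundle EG EQ EB G Q}

namespace DiscreteConnection

variable (A : DiscreteConnection h)

/-- The differential `dΥ(z)(a, b)`, for `a ∈ T_{z₁}Q` and `b ∈ T_{z₂}Q`. -/
def dUpsilon (z : Q × Q) (a : TangentSpace 𝓘(ℝ, EQ) z.1) (b : TangentSpace 𝓘(ℝ, EQ) z.2) :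
    TangentSpace ((𝓘(ℝ, EB).prod 𝓘(ℝ, EG)).prod 𝓘(ℝ, EB)) (A.Upsilon z) :=
  mfderiv (𝓘(ℝ, EQ).prod 𝓘(ℝ, EQ)) ((𝓘(ℝ, EB).prod 𝓘(ℝ, EG)).prod 𝓘(ℝ, EB)) A.Upsilon z
    (tpair a b)

/-- The partial differential `D₂(p₁ ∘ Υ)(q₀, q₁)(b)`, for `b ∈ T_{q₁}Q`. -/
def dUpsilon₂ (q₀ q₁ : Q) (b : TangentSpace 𝓘(ℝ, EQ) q₁) :
    TangentSpace (𝓘(ℝ, EB).prod 𝓘(ℝ, EG)) (A.Upsilon (q₀, q₁)).1 :=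
  mfderiv 𝓘(ℝ, EQ) (𝓘(ℝ, EB).prod 𝓘(ℝ, EG)) (fun q => (A.Upsilon (q₀, q)).1) q₁ b

/-- The path `(v_k, r_{k+1}) = Υ(q_k, q_{k+1})`, `k = 0, …, N - 1`. -/
def reducedPath {N : ℕ} (q : Fin (N + 1) → Q) (k : Fin N) : ConjBundle h × OrbitSpace G Q :=
  A.Upsilon (q k.castSucc, q k.succ)

/-- The variation `(δv_k, δr_{k+1}) = dΥ(q_k, q_{k+1})(δq_k, δq_{k+1})`. -/
def reducedVariation {N : ℕ} (q : Fin (N + 1) → Q) (δq : ∀ k, TangentSpace 𝓘(ℝ, EQ) (q k))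
    (k : Fin N) :
    TangentSpace ((𝓘(ℝ, EB).prod 𝓘(ℝ, EG)).prod 𝓘(ℝ, EB)) (A.reducedPath q k) :=
  A.dUpsilon (q k.castSucc, q k.succ) (δq k.castSucc) (δq k.succ)

variable (S : DNHMS EQ Q)

open Classical in
/-- The reduced Lagrangian: `Ľ_d(v₀, r₁) = L_d(q₀, q₁)` if `(v₀, r₁) = Υ(q₀, q₁)`. -/
def reducedL (x : ConjBundle h × OrbitSpace G Q) : ℝ :=
  if hx : ∃ z ∈ A.domain, A.Upsilon z = x then S.L hx.choose else 0

/-- The fiber at `y` of `𝒟̌ = dΥ(p₁^*(𝒟^{nh}))`: the vectors `(w, 0) = dΥ(q₀, q₁)(v, 0)` with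
`Υ(q₀, q₁) = y` and `v ∈ 𝒟^{nh}_{q₀}`. (These vectors form a linear subspace.) -/
def reducedD (y : ConjBundle h × OrbitSpace G Q) :
    Submodule ℝ (TangentSpace (𝓘(ℝ, EB).prod 𝓘(ℝ, EG)) y.1) :=
  Submodule.span ℝ {w | ∃ z ∈ A.domain, ∃ v ∈ S.D z.1,
    (⟨y, tpair w 0⟩ : TangentBundle ((𝓘(ℝ, EB).prod 𝓘(ℝ, EG)).prod 𝓘(ℝ, EB))
      (ConjBundle h × OrbitSpace G Q)) = ⟨A.Upsilon z, A.dUpsilon z v 0⟩}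

/-- The defining property of the chaining map `𝒫̌(x, y) : 𝒟̌_y → ker dp^{Q/G}`:
`𝒫̌(x, y)(w) = D₂(p₁ ∘ Υ)(q₀, q₁)(δq₁)` whenever `x = Υ(q₀, q₁)`, `y = Υ(q₁, q₂)`,
`δq₁ ∈ 𝒟^{nh}_{q₁}` and `(w, 0) = dΥ(q₁, q₂)(δq₁, 0)`. -/
def IsReducedP (x y : ConjBundle h × OrbitSpace G Q)
    (f : A.reducedD S y →ₗ[ℝ] LinearMap.ker
      (mfderiv (𝓘(ℝ, EB).prod 𝓘(ℝ, EG)) 𝓘(ℝ, EB) (conjProj h) x.1).toLinearMap) : Prop :=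
  ∀ q₀ q₁ q₂ : Q, (q₀, q₁) ∈ A.domain → (q₁, q₂) ∈ A.domain →
    A.Upsilon (q₀, q₁) = x → ∀ δq₁ ∈ S.D q₁, ∀ w : A.reducedD S y,
    (⟨y, tpair (w : TangentSpace (𝓘(ℝ, EB).prod 𝓘(ℝ, EG)) y.1) 0⟩ :
      TangentBundle ((𝓘(ℝ, EB).prod 𝓘(ℝ, EG)).prod 𝓘(ℝ, EB)) (ConjBundle h × OrbitSpace G Q)) =
      ⟨A.Upsilon (q₁, q₂), A.dUpsilon (q₁, q₂) δq₁ 0⟩ →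
    (⟨x.1, (f w : TangentSpace (𝓘(ℝ, EB).prod 𝓘(ℝ, EG)) x.1)⟩ :
      TangentBundle (𝓘(ℝ, EB).prod 𝓘(ℝ, EG)) (ConjBundle h)) =
      ⟨(A.Upsilon (q₀, q₁)).1, A.dUpsilon₂ q₀ q₁ δq₁⟩

open Classical in
/-- The reduced chaining map `𝒫̌`, the linear map with the property `IsReducedP`. -/
def reducedP (x y : ConjBundle h × OrbitSpace G Q) :
    A.reducedD S y →ₗ[ℝ] LinearMap.ker
      (mfderiv (𝓘(ℝ, EB).prod 𝓘(ℝ, EG)) 𝓘(ℝ, EB) (conjProj h) x.1).toLinearMap :=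
  if hf : ∃ f, A.IsReducedP S x y f then hf.choose else 0

/-- The discrete Lagrange--D'Alembert--Poincaré system `(G̃, Ľ_d, 𝒟̌_d, 𝒟̌, 𝒫̌)` over
`p^{Q/G} : G̃ → Q/G` associated with the symmetric system `S` and the discrete connection `A`. -/
def reducedSystem :
    DLDPSData (𝓘(ℝ, EB).prod 𝓘(ℝ, EG)) 𝓘(ℝ, EB) (conjProj h) where
  dom := A.Upsilon '' A.domain
  L := A.reducedL S
  Dd := A.Upsilon '' (S.Dd ∩ A.domain)
  D := A.reducedD S
  P := A.reducedP S

/-- The variational principle of the reduced system of Fernández, Tori and Zuccalli, for the path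
`(v_k, r_{k+1}) = Υ(q_k, q_{k+1})`: it lies in `𝒟̌_d` and the reduced action is critical for the
variations obtained by applying `dΥ` to the fixed-endpoint variations on `q` in `𝒟^{nh}`. -/
def ReducedPrinciple {N : ℕ} (q : Fin (N + 1) → Q) : Prop :=
  (∀ k, A.reducedPath q k ∈ A.Upsilon '' (S.Dd ∩ A.domain)) ∧
  ∀ δq : ∀ k, TangentSpace 𝓘(ℝ, EQ) (q k), S.IsFixedEndpointVariation q δq →
    (A.reducedSystem S).dAction (A.reducedPath q) (A.reducedVariation q δq) = 0

/-- Trajectories of the reduced system of Fernández, Tori and Zuccalli. -/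
def IsReducedTrajectory {N : ℕ} (x : Fin N → ConjBundle h × OrbitSpace G Q) : Prop :=
  ∃ q : Fin (N + 1) → Q, (∀ k : Fin N, (q k.castSucc, q k.succ) ∈ A.domain) ∧
    A.reducedPath q = x ∧ A.ReducedPrinciple S q

end DiscreteConnection

end Mechanics

end DiscreteReduction

end

open DiscreteReduction

/-! On `A.domain` the map `Υ` behaves like the quotient map of the free diagonal `G`-action. It is
invariant, because the connection form is conjugated by `g` under translation. Its fibers are single
orbits (`exists_smul_eq_of_upsilon_eq`), and it has a smooth local section through every point
(`exists_local_section`). Hence the image is open and every invariant object on `Q × Q` descends: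
locally the reduced Lagrangian is `L` composed with a section, and the fibers of the reduced
constraint distribution do not depend on the representative.

The infinitesimal input is that `dΥ(z)(v, 0) = 0` forces `v = 0` (`dUpsilonFst_injective`). Knowing
`Υ(z)` fixes `z` up to translation, and by freeness the second point fixes the translation. So the
first point is locally a smooth function of `Υ(z)` and the second point. Therefore each `w` in the
reduced distribution at `Υ(q₁, q₂)` comes from exactly one `δq₁ ∈ 𝒟^{nh}`, and the chaining map is
`D₂(p₁ ∘ Υ)(q₀, q₁)` applied to that `δq₁`. Independence of representatives again uses freeness,
since the two consecutive pairs share the point `q₁` and so are translated by the same group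
element.

The correspondence of variations is then a splitting. Writing `(δq_k, δq_{k+1}) = (δq_k, 0) + (0,
δq_{k+1})`, the first component of `dΥ(δq_k, δq_{k+1})` is `w_k + 𝒫̌(w_{k+1})`, where `w_k` is the
image of `δq_k`. The second component is `dπ(δq_{k+1})`, which equals `dφ(w_{k+1})`, hence
`dφ(δv_{k+1})`, because `𝒫̌` takes values in `ker dφ`. Thus `δq ↦ w` is a bijection, with `δq_0 = 0`
matching `w_0 = 0` and `δq_N = 0` matching both `δr_N = 0` and the absence of a chaining term in the
last step. The two variational principles test the same differential on the same vectors, and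
trajectories agree once every reduced path is lifted to `Q` (`exists_lift_of_isPath`). -/

namespace DiscreteReduction

/-! ### Orbits and the quotient map. -/

section Orbits

variable {G Q : Type*} [Group G] [MulAction G Q]

theorem orbitMk_smul (g : G) (q : Q) : orbitMk G (g • q) = orbitMk G q :=
  Quotient.sound ⟨g, rfl⟩

theorem orbitMk_eq_iff {q q' : Q} : orbitMk G q = orbitMk G q' ↔ ∃ g : G, q = g • q' := by
  refine ⟨fun hq => ?_, ?_⟩
  · obtain ⟨g, hg⟩ := Quotient.exact hq
    exact ⟨g, hg.symm⟩
  · rintro ⟨g, rfl⟩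
    exact orbitMk_smul g q'

end Orbits

/-! ### Freeness, and smooth maps to and from the conjugate bundle. -/

section Bundle

variable {EG EQ EB : Type*}
  [NormedAddCommGroup EG] [NormedSpace ℝ EG] [NormedAddCommGroup EQ] [NormedSpace ℝ EQ]
  [NormedAddCommGroup EB] [NormedSpace ℝ EB]
  {G Q : Type*} [Group G] [TopologicalSpace G] [ChartedSpace EG G]
  [TopologicalSpace Q] [ChartedSpace EQ Q] [MulAction G Q]
  [ChartedSpace EB (OrbitSpace G Q)]

namespace IsTrivialization

variable {Φ : PartialDiffeomorph 𝓘(ℝ, EQ) (𝓘(ℝ, EB).prod 𝓘(ℝ, EG)) Q (OrbitSpace G Q × G) ∞}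
  {U : Set (OrbitSpace G Q)}

theorem mem_source_iff (hΦ : IsTrivialization Φ U) {q : Q} :
    q ∈ Φ.source ↔ orbitMk G q ∈ U := by
  rw [hΦ.source_eq]; rfl

theorem contMDiffAt (hΦ : IsTrivialization Φ U) {q : Q} (hq : orbitMk G q ∈ U) :
    ContMDiffAt 𝓘(ℝ, EQ) (𝓘(ℝ, EB).prod 𝓘(ℝ, EG)) ∞ Φ q :=
  Φ.contMDiffOn_toFun.contMDiffAt (Φ.open_source.mem_nhds (hΦ.mem_source_iff.2 hq))

theorem contMDiffAt_inv (hΦ : IsTrivialization Φ U) {p : OrbitSpace G Q × G} (hp : p.1 ∈ U) :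
    ContMDiffAt (𝓘(ℝ, EB).prod 𝓘(ℝ, EG)) 𝓘(ℝ, EQ) ∞ Φ.invFun p :=
  Φ.contMDiffOn_invFun.contMDiffAt (Φ.open_target.mem_nhds (by
    rw [hΦ.target_eq]; exact ⟨hp, trivial⟩))

theorem contMDiffAt_coord (hΦ : IsTrivialization Φ U) {q : Q} (hq : orbitMk G q ∈ U) :
    ContMDiffAt 𝓘(ℝ, EQ) 𝓘(ℝ, EG) ∞ (fun q => (Φ q).2) q :=
  contMDiffAt_snd.comp q (hΦ.contMDiffAt hq)

/-- The action of `G` is free over the base of a trivialization. -/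
theorem smul_cancel (hΦ : IsTrivialization Φ U) {q : Q} (hq : orbitMk G q ∈ U) {g g' : G}
    (hg : g • q = g' • q) : g = g' := by
  have hs := hΦ.mem_source_iff.2 hq
  have := (hΦ.equivariant q hs g).symm.trans ((by rw [hg]) : _ = (Φ (g' • q)).2)
  rw [hΦ.equivariant q hs g'] at this
  exact mul_right_cancel this

/-- Two points of the same orbit are translated into each other by the quotient of their
coordinates in `G`. -/
theorem mul_inv_smul (hΦ : IsTrivialization Φ U) {q q' : Q} (hq : orbitMk G q ∈ U)
    (hqq' : orbitMk G q = orbitMk G q') : ((Φ q).2 * (Φ q').2⁻¹) • q' = q := by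
  obtain ⟨g, rfl⟩ := orbitMk_eq_iff.1 hqq'
  rw [hΦ.equivariant q' (hΦ.mem_source_iff.2 (hqq' ▸ hq)) g, mul_inv_cancel_right]

end IsTrivialization

namespace IsPrincipalBundle

theorem smul_cancel (h : IsPrincipalBundle EG EQ EB G Q) {q : Q} {g g' : G}
    (hg : g • q = g' • q) : g = g' := by
  obtain ⟨U, Φ, hq, hΦ⟩ := h.exists_trivialization (orbitMk G q)
  exact hΦ.smul_cancel hq hg

theorem contMDiff_orbitMk (h : IsPrincipalBundle EG EQ EB G Q) :
    ContMDiff 𝓘(ℝ, EQ) 𝓘(ℝ, EB) ∞ (orbitMk G : Q → OrbitSpace G Q) := by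
  intro q
  obtain ⟨U, Φ, hq, hΦ⟩ := h.exists_trivialization (orbitMk G q)
  refine (contMDiffAt_fst.comp q (hΦ.contMDiffAt hq)).congr_of_eventuallyEq ?_
  filter_upwards [Φ.open_source.mem_nhds (hΦ.mem_source_iff.2 hq)] with q' hq'
  exact (hΦ.fst_eq q' hq').symm

theorem contMDiff_const_smul (h : IsPrincipalBundle EG EQ EB G Q) (g : G) :
    ContMDiff 𝓘(ℝ, EQ) 𝓘(ℝ, EQ) ∞ (fun q : Q => g • q) :=
  h.smooth_action.contMDiff_smul.comp (contMDiff_const.prodMk contMDiff_id)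

end IsPrincipalBundle

variable [LieGroup 𝓘(ℝ, EG) ∞ G] [IsManifold 𝓘(ℝ, EB) ∞ (OrbitSpace G Q)]
  (h : IsPrincipalBundle EG EQ EB G Q)
  {Φ : PartialDiffeomorph 𝓘(ℝ, EQ) (𝓘(ℝ, EB).prod 𝓘(ℝ, EG)) Q (OrbitSpace G Q × G) ∞}
  {U : Set (OrbitSpace G Q)}

theorem conjTriv_trans_mem_maximalAtlas (hΦ : IsTrivialization Φ U) (p : OrbitSpace G Q × G) :
    conjTriv h hΦ ≫ₕ chartAt (ModelProd EB EG) p ∈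
      IsManifold.maximalAtlas (𝓘(ℝ, EB).prod 𝓘(ℝ, EG)) ∞ (ConjBundle h) :=
  IsManifold.subset_maximalAtlas ⟨U, Φ, hΦ, _, chart_mem_atlas _ p, rfl⟩

/-- The charts of `G̃` are `conjTriv` followed by a chart `e` of `(Q/G) × G`, so `conjTriv` is
locally such a chart followed by `e.symm`. -/
theorem contMDiffAt_conjTriv (hΦ : IsTrivialization Φ U) {z : ConjBundle h}
    (hz : conjProj h z ∈ U) :
    ContMDiffAt (𝓘(ℝ, EB).prod 𝓘(ℝ, EG)) (𝓘(ℝ, EB).prod 𝓘(ℝ, EG)) ∞ (conjTriv h hΦ) z := by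
  set e := chartAt (ModelProd EB EG) (conjTriv h hΦ z)
  have hzs : z ∈ (conjTriv h hΦ ≫ₕ e).source := by
    rw [OpenPartialHomeomorph.trans_source]
    exact ⟨hz, mem_chart_source (ModelProd EB EG) (conjTriv h hΦ z)⟩
  have h1 := (contMDiffOn_of_mem_maximalAtlas
    (conjTriv_trans_mem_maximalAtlas h hΦ (conjTriv h hΦ z))).contMDiffAt
    ((conjTriv h hΦ ≫ₕ e).open_source.mem_nhds hzs)
  have h2 : ContMDiffAt (𝓘(ℝ, EB).prod 𝓘(ℝ, EG)) (𝓘(ℝ, EB).prod 𝓘(ℝ, EG)) ∞ e.symm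
      ((conjTriv h hΦ ≫ₕ e) z) :=
    (contMDiffOn_chart_symm (x := conjTriv h hΦ z)).contMDiffAt
      (e.open_target.mem_nhds (e.map_source (mem_chart_source _ _)))
  refine (h2.comp z h1).congr_of_eventuallyEq ?_
  filter_upwards [(conjTriv h hΦ ≫ₕ e).open_source.mem_nhds hzs] with y hy
  rw [OpenPartialHomeomorph.trans_source] at hy
  exact (e.left_inv hy.2).symm

theorem contMDiffAt_conjTriv_symm (hΦ : IsTrivialization Φ U) {p : OrbitSpace G Q × G}
    (hp : p.1 ∈ U) :
    ContMDiffAt (𝓘(ℝ, EB).prod 𝓘(ℝ, EG)) (𝓘(ℝ, EB).prod 𝓘(ℝ, EG)) ∞ (conjTriv h hΦ).symm p := by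
  set e := chartAt (ModelProd EB EG) p
  have hpt : p ∈ (conjTriv h hΦ).target := ⟨hp, trivial⟩
  have h1 : ContMDiffAt (𝓘(ℝ, EB).prod 𝓘(ℝ, EG)) (𝓘(ℝ, EB).prod 𝓘(ℝ, EG)) ∞ e p :=
    (contMDiffOn_chart (x := p)).contMDiffAt (e.open_source.mem_nhds (mem_chart_source _ _))
  have het : e p ∈ (conjTriv h hΦ ≫ₕ e).target := by
    rw [OpenPartialHomeomorph.trans_target]
    refine ⟨e.map_source (mem_chart_source _ _), ?_⟩
    change e.symm (e p) ∈ (conjTriv h hΦ).target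
    rw [e.left_inv (mem_chart_source _ _)]
    exact hpt
  have h2 := (contMDiffOn_symm_of_mem_maximalAtlas
    (conjTriv_trans_mem_maximalAtlas h hΦ p)).contMDiffAt
    ((conjTriv h hΦ ≫ₕ e).open_target.mem_nhds het)
  refine (h2.comp p h1).congr_of_eventuallyEq ?_
  filter_upwards [e.open_source.mem_nhds (mem_chart_source _ _)] with y hy
  change _ = (conjTriv h hΦ).symm (e.symm (e y))
  rw [e.left_inv hy]

/-- With `a(q)` the `G`-coordinate of a trivialization, the map reads `(q, w) ↦ (π(q), a(q)⁻¹ w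
a(q))`, a smooth expression. -/
theorem contMDiff_conjMk :
    ContMDiff (𝓘(ℝ, EQ).prod 𝓘(ℝ, EG)) (𝓘(ℝ, EB).prod 𝓘(ℝ, EG)) ∞
      (fun z : Q × G => conjMk h z.1 z.2) := by
  rintro ⟨q, w⟩
  obtain ⟨U, Φ, hq, hΦ⟩ := h.exists_trivialization (orbitMk G q)
  have ha : ContMDiffAt (𝓘(ℝ, EQ).prod 𝓘(ℝ, EG)) 𝓘(ℝ, EG) ∞
      (fun z : Q × G => (Φ z.1).2) (q, w) :=
    ContMDiffAt.comp (g := fun q => (Φ q).2) (q, w) (hΦ.contMDiffAt_coord hq) contMDiffAt_fst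
  have hF : ContMDiffAt (𝓘(ℝ, EQ).prod 𝓘(ℝ, EG)) (𝓘(ℝ, EB).prod 𝓘(ℝ, EG)) ∞
      (fun z : Q × G => (orbitMk G z.1, (Φ z.1).2⁻¹ * z.2 * (Φ z.1).2)) (q, w) :=
    (h.contMDiff_orbitMk.contMDiffAt.comp (q, w) contMDiffAt_fst).prodMk
      ((ha.inv.mul contMDiffAt_snd).mul ha)
  refine (ContMDiffAt.comp (q, w) (contMDiffAt_conjTriv_symm h hΦ
    (p := (orbitMk G q, (Φ q).2⁻¹ * w * (Φ q).2)) hq) hF).congr_of_eventuallyEq ?_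
  have hs : ∀ᶠ y : Q × G in 𝓝 (q, w), y.1 ∈ Φ.source :=
    (Φ.open_source.preimage continuous_fst).mem_nhds (hΦ.mem_source_iff.2 hq)
  filter_upwards [hs] with y hy
  have hy' := hΦ.mem_source_iff.1 hy
  exact ((congrArg (conjTriv h hΦ).symm (conjTrivFun_mk (h := h) hΦ hy' y.2).symm).trans
    ((conjTriv h hΦ).left_inv (x := conjMk h y.1 y.2) hy')).symm

theorem contMDiff_conjProj :
    ContMDiff (𝓘(ℝ, EB).prod 𝓘(ℝ, EG)) 𝓘(ℝ, EB) ∞ (conjProj h) := by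
  intro z
  obtain ⟨U, Φ, hz, hΦ⟩ := h.exists_trivialization (conjProj h z)
  refine (contMDiffAt_fst.comp z (contMDiffAt_conjTriv h hΦ hz)).congr_of_eventuallyEq
    (Filter.Eventually.of_forall fun y => ?_)
  obtain ⟨q, w, rfl⟩ := exists_conjMk h y
  rfl

end Bundle

namespace DiscreteConnection

/-! ### Invariance and fibers of `Υ`; openness of the domain. -/

section Algebra

variable {EG EQ EB : Type*}
  [NormedAddCommGroup EG] [NormedSpace ℝ EG] [NormedAddCommGroup EQ] [NormedSpace ℝ EQ]
  [NormedAddCommGroup EB] [NormedSpace ℝ EB]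
  {G Q : Type*} [Group G] [TopologicalSpace G] [ChartedSpace EG G]
  [TopologicalSpace Q] [ChartedSpace EQ Q] [MulAction G Q]
  [ChartedSpace EB (OrbitSpace G Q)]
  {h : IsPrincipalBundle EG EQ EB G Q} (A : DiscreteConnection h)

theorem mem_domain_iff {z : Q × Q} :
    z ∈ A.domain ↔ ∃ q, (z.1, q) ∈ A.Hor ∧ orbitMk G q = orbitMk G z.2 := by
  refine exists_congr fun q => ⟨?_, ?_⟩
  · rintro ⟨g, hq, hg⟩
    exact ⟨hq, by rw [hg, orbitMk_smul]⟩
  · rintro ⟨hq, hg⟩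
    obtain ⟨g, hg⟩ := orbitMk_eq_iff.1 hg.symm
    exact ⟨g, hq, hg⟩

theorem smul_mem_domain (g : G) {z : Q × Q} (hz : z ∈ A.domain) : g • z ∈ A.domain := by
  obtain ⟨q, hq, hqz⟩ := A.mem_domain_iff.1 hz
  exact A.mem_domain_iff.2 ⟨g • q, A.invariant g _ _ hq,
    by rw [orbitMk_smul, hqz, Prod.smul_snd, orbitMk_smul]⟩

theorem form_spec {z : Q × Q} (hz : z ∈ A.domain) : (z.1, (A.form z)⁻¹ • z.2) ∈ A.Hor := by
  have hex : ∃ g : G, (z.1, g⁻¹ • z.2) ∈ A.Hor := by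
    obtain ⟨q, g, hq, hg⟩ := hz
    exact ⟨g, by rwa [hg, inv_smul_smul]⟩
  rw [form, dif_pos hex]
  exact hex.choose_spec

theorem mem_domain_of_mem_hor {z : Q × Q} {q : Q} {g : G} (hq : (z.1, q) ∈ A.Hor)
    (hg : z.2 = g • q) : z ∈ A.domain :=
  ⟨q, g, hq, hg⟩

/-- Uniqueness of the connection form: injectivity of `id × π` on `Hor` determines the horizontal
point over the orbit of `z.2`, and freeness then determines the group element. -/
theorem form_eq {z : Q × Q} {q : Q} {g : G} (hq : (z.1, q) ∈ A.Hor) (hg : z.2 = g • q) :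
    A.form z = g := by
  have h1 := A.form_spec (A.mem_domain_of_mem_hor hq hg)
  have h2 : (A.form z)⁻¹ • z.2 = q := congrArg Prod.snd <| A.injOn h1 hq <| Prod.ext rfl <| by
    change orbitMk G _ = orbitMk G q
    rw [orbitMk_smul, hg, orbitMk_smul]
  refine h.smul_cancel (q := q) ?_
  rw [← hg, ← h2, smul_inv_smul]

theorem form_smul (g : G) {z : Q × Q} (hz : z ∈ A.domain) :
    A.form (g • z) = g * A.form z * g⁻¹ := by
  refine A.form_eq (A.invariant g _ _ (A.form_spec hz)) ?_
  simp [mul_smul]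

theorem upsilon_smul (g : G) {z : Q × Q} (hz : z ∈ A.domain) :
    A.Upsilon (g • z) = A.Upsilon z := by
  refine Prod.ext ?_ (orbitMk_smul g z.2)
  change conjMk h (g • z.1) (A.form (g • z)) = conjMk h z.1 (A.form z)
  rw [A.form_smul g hz, conjMk_smul]

/-- The fibers of `Υ` are the orbits of the diagonal action. -/
theorem exists_smul_eq_of_upsilon_eq {z z' : Q × Q} (hz : z ∈ A.domain) (hz' : z' ∈ A.domain)
    (hzz' : A.Upsilon z = A.Upsilon z') : ∃ g : G, z' = g • z := by
  have h1 : conjMk h z'.1 (A.form z') = conjMk h z.1 (A.form z) := congrArg Prod.fst hzz'.symm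
  have h2 : orbitMk G z'.2 = orbitMk G z.2 := congrArg Prod.snd hzz'.symm
  -- Equality in `G̃` gives a `g` that matches the first points and conjugates one form into the
  -- other. Removing the common form from the second points leaves two horizontal points over the
  -- same pair in `Q × Q/G`, which coincide by `injOn`.
  obtain ⟨g, hg⟩ := Quotient.exact h1
  have hg1 : g • z.1 = z'.1 := congrArg Prod.fst hg
  have hg2 : g * A.form z * g⁻¹ = A.form z' := congrArg Prod.snd hg
  have h3 := A.form_spec hz'
  have h4 := A.form_spec (A.smul_mem_domain g hz)
  rw [A.form_smul g hz, hg2, Prod.smul_fst, hg1] at h4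
  have h5 : (A.form z')⁻¹ • z'.2 = (A.form z')⁻¹ • (g • z).2 :=
    congrArg Prod.snd <| A.injOn h3 h4 <| Prod.ext rfl <| by
      change orbitMk G _ = orbitMk G _
      rw [orbitMk_smul, orbitMk_smul, h2, Prod.smul_snd, orbitMk_smul]
  exact ⟨g, Prod.ext hg1.symm (smul_left_cancel _ h5)⟩

/-- Local smooth horizontal lifts of points of `Q/G`. -/
theorem exists_horizontal_lift {z : Q × Q} (hz : z ∈ A.domain) :
    ∃ (O : Set (Q × OrbitSpace G Q)) (s : Q × OrbitSpace G Q → Q), IsOpen O ∧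
      (z.1, orbitMk G z.2) ∈ O ∧
      ContMDiffOn (𝓘(ℝ, EQ).prod 𝓘(ℝ, EB)) 𝓘(ℝ, EQ) ∞ s O ∧
      ∀ p ∈ O, (p.1, s p) ∈ A.Hor ∧ orbitMk G (s p) = p.2 := by
  obtain ⟨q, hq, hqz⟩ := A.mem_domain_iff.1 hz
  obtain ⟨W, O, σ, -, hW, hO, hσ, hfO, hσW, -, hr⟩ := A.localDiffeo _ hq
  -- The lift is the second component of the local inverse of `id × π` on `Hor`; the first component
  -- of that inverse is necessarily `p.1`.
  refine ⟨O, fun p => (σ p).2, hO, ?_, contMDiff_snd.comp_contMDiffOn hσ, fun p hp => ?_⟩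
  · rw [← hqz]
    exact hfO ⟨hq, hW⟩
  · have h1 := hr hp
    have h2 : (σ p).1 = p.1 := congrArg Prod.fst h1
    exact ⟨h2 ▸ (hσW hp).1, congrArg Prod.snd h1⟩

theorem isOpen_domain : IsOpen A.domain := by
  refine isOpen_iff_mem_nhds.2 fun z hz => ?_
  obtain ⟨O, s, hO, hzO, -, hs⟩ := A.exists_horizontal_lift hz
  have hc : Continuous fun z : Q × Q => (z.1, orbitMk G z.2) :=
    continuous_fst.prodMk (h.contMDiff_orbitMk.continuous.comp continuous_snd)
  filter_upwards [(hO.preimage hc).mem_nhds hzO] with y hy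
  exact A.mem_domain_iff.2 ⟨_, hs _ hy⟩

end Algebra

/-! ### Smoothness and local sections of `Υ`. -/

section Smooth

variable {EG EQ EB : Type*}
  [NormedAddCommGroup EG] [NormedSpace ℝ EG] [NormedAddCommGroup EQ] [NormedSpace ℝ EQ]
  [NormedAddCommGroup EB] [NormedSpace ℝ EB]
  {G Q : Type*} [Group G] [TopologicalSpace G] [ChartedSpace EG G] [LieGroup 𝓘(ℝ, EG) ∞ G]
  [TopologicalSpace Q] [ChartedSpace EQ Q] [MulAction G Q]
  [ChartedSpace EB (OrbitSpace G Q)]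
  {h : IsPrincipalBundle EG EQ EB G Q} (A : DiscreteConnection h)

theorem contMDiffAt_form {z : Q × Q} (hz : z ∈ A.domain) :
    ContMDiffAt (𝓘(ℝ, EQ).prod 𝓘(ℝ, EQ)) 𝓘(ℝ, EG) ∞ A.form z := by
  obtain ⟨O, s, hO, hzO, hsm, hs⟩ := A.exists_horizontal_lift hz
  obtain ⟨U, Φ, hU, hΦ⟩ := h.exists_trivialization (orbitMk G z.2)
  have hc : ContMDiff (𝓘(ℝ, EQ).prod 𝓘(ℝ, EQ)) (𝓘(ℝ, EQ).prod 𝓘(ℝ, EB)) ∞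
      (fun z : Q × Q => (z.1, orbitMk G z.2)) :=
    contMDiff_fst.prodMk (h.contMDiff_orbitMk.comp contMDiff_snd)
  have h1 : ContMDiffAt (𝓘(ℝ, EQ).prod 𝓘(ℝ, EQ)) 𝓘(ℝ, EQ) ∞
      (fun z : Q × Q => s (z.1, orbitMk G z.2)) z :=
    ContMDiffAt.comp z (hsm.contMDiffAt (hO.mem_nhds hzO)) hc.contMDiffAt
  have h2 : ContMDiffAt (𝓘(ℝ, EQ).prod 𝓘(ℝ, EQ)) 𝓘(ℝ, EG) ∞
      (fun z : Q × Q => (Φ (s (z.1, orbitMk G z.2))).2) z :=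
    ContMDiffAt.comp (g := fun q => (Φ q).2) z
      (hΦ.contMDiffAt_coord (by rw [(hs _ hzO).2]; exact hU)) h1
  have h3 : ContMDiffAt (𝓘(ℝ, EQ).prod 𝓘(ℝ, EQ)) 𝓘(ℝ, EG) ∞ (fun z : Q × Q => (Φ z.2).2) z :=
    ContMDiffAt.comp (g := fun q => (Φ q).2) z (hΦ.contMDiffAt_coord hU) contMDiffAt_snd
  -- The second point and its horizontal representative lie in one orbit, so the form is the
  -- quotient of their `G`-coordinates in a trivialization.
  refine (h3.mul h2.inv).congr_of_eventuallyEq ?_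
  filter_upwards [(hO.preimage hc.continuous).mem_nhds hzO,
    (hΦ.isOpen_base.preimage (h.contMDiff_orbitMk.continuous.comp continuous_snd)).mem_nhds hU]
    with y hyO hyU
  exact A.form_eq (hs _ hyO).1 (hΦ.mul_inv_smul hyU (hs _ hyO).2.symm).symm

variable [IsManifold 𝓘(ℝ, EB) ∞ (OrbitSpace G Q)]

theorem contMDiffAt_upsilon {z : Q × Q} (hz : z ∈ A.domain) :
    ContMDiffAt (𝓘(ℝ, EQ).prod 𝓘(ℝ, EQ)) ((𝓘(ℝ, EB).prod 𝓘(ℝ, EG)).prod 𝓘(ℝ, EB)) ∞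
      A.Upsilon z :=
  (ContMDiffAt.comp (g := fun z : Q × G => conjMk h z.1 z.2) z (contMDiff_conjMk h).contMDiffAt
    (contMDiffAt_fst.prodMk (A.contMDiffAt_form hz))).prodMk
    (h.contMDiff_orbitMk.comp contMDiff_snd).contMDiffAt

/-- `Υ` has a smooth local section through every point of its domain. -/
theorem exists_local_section {z : Q × Q} (hz : z ∈ A.domain) :
    ∃ σ : ConjBundle h × OrbitSpace G Q → Q × Q,
      ContMDiffAt ((𝓘(ℝ, EB).prod 𝓘(ℝ, EG)).prod 𝓘(ℝ, EB)) (𝓘(ℝ, EQ).prod 𝓘(ℝ, EQ)) ∞ σ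
        (A.Upsilon z) ∧
      σ (A.Upsilon z) = z ∧
      ∀ᶠ y in 𝓝 (A.Upsilon z), σ y ∈ A.domain ∧ A.Upsilon (σ y) = y := by
  obtain ⟨U, Φ, hU, hΦ⟩ := h.exists_trivialization (orbitMk G z.1)
  have hU' : conjProj h (A.Upsilon z).1 ∈ U := hU
  -- The section will start at the point with `G`-coordinate `1`, which is `k • z.1` over the orbit
  -- of `z.1`. The horizontal lift is therefore taken around `k • z`.
  obtain ⟨k, hk⟩ := orbitMk_eq_iff.1 (hΦ.mk_inv hU 1)
  obtain ⟨O, s, hO, hzO, hsm, hs⟩ := A.exists_horizontal_lift (A.smul_mem_domain k hz)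
  have hf : ContMDiffAt ((𝓘(ℝ, EB).prod 𝓘(ℝ, EG)).prod 𝓘(ℝ, EB))
      (𝓘(ℝ, EB).prod 𝓘(ℝ, EG)) ∞
      (fun y : ConjBundle h × OrbitSpace G Q => conjTriv h hΦ y.1) (A.Upsilon z) :=
    ContMDiffAt.comp (A.Upsilon z) (contMDiffAt_conjTriv h hΦ hU') contMDiffAt_fst
  have hp : ContMDiffAt ((𝓘(ℝ, EB).prod 𝓘(ℝ, EG)).prod 𝓘(ℝ, EB)) 𝓘(ℝ, EQ) ∞
      (fun y : ConjBundle h × OrbitSpace G Q => Φ.invFun (conjProj h y.1, 1)) (A.Upsilon z) :=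
    ContMDiffAt.comp (A.Upsilon z)
      (hΦ.contMDiffAt_inv (p := (conjProj h (A.Upsilon z).1, 1)) hU')
      (((contMDiff_conjProj h).comp contMDiff_fst).contMDiffAt.prodMk contMDiffAt_const)
  have hpk : Φ.invFun (conjProj h (A.Upsilon z).1, 1) = (k • z).1 := hk
  have hzO' : (Φ.invFun (conjProj h (A.Upsilon z).1, 1), (A.Upsilon z).2) ∈ O := by
    rw [hpk]
    rwa [Prod.smul_snd, orbitMk_smul] at hzO
  have hq : ContMDiffAt ((𝓘(ℝ, EB).prod 𝓘(ℝ, EG)).prod 𝓘(ℝ, EB)) 𝓘(ℝ, EQ) ∞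
      (fun y : ConjBundle h × OrbitSpace G Q => s (Φ.invFun (conjProj h y.1, 1), y.2))
      (A.Upsilon z) :=
    ContMDiffAt.comp (A.Upsilon z) (hsm.contMDiffAt (hO.mem_nhds hzO'))
      (hp.prodMk contMDiffAt_snd)
  have hσ : ContMDiffAt ((𝓘(ℝ, EB).prod 𝓘(ℝ, EG)).prod 𝓘(ℝ, EB))
      (𝓘(ℝ, EQ).prod 𝓘(ℝ, EQ)) ∞ (fun y : ConjBundle h × OrbitSpace G Q =>
        (Φ.invFun (conjProj h y.1, 1),
          (conjTriv h hΦ y.1).2 • s (Φ.invFun (conjProj h y.1, 1), y.2))) (A.Upsilon z) :=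
    hp.prodMk (ContMDiffAt.comp (A.Upsilon z) h.smooth_action.contMDiff_smul.contMDiffAt
      ((contMDiffAt_snd.comp (A.Upsilon z) hf).prodMk hq))
  -- For `y = (v, r)`, write `v = [q, a]` with `q` of `G`-coordinate `1`. The pair `(q, a • s(q,
  -- r))` then has form `a` and second orbit `r`.
  have hev : ∀ y : ConjBundle h × OrbitSpace G Q, conjProj h y.1 ∈ U →
      (Φ.invFun (conjProj h y.1, 1), y.2) ∈ O →
      (Φ.invFun (conjProj h y.1, 1),
        (conjTriv h hΦ y.1).2 • s (Φ.invFun (conjProj h y.1, 1), y.2)) ∈ A.domain ∧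
      A.Upsilon (Φ.invFun (conjProj h y.1, 1),
        (conjTriv h hΦ y.1).2 • s (Φ.invFun (conjProj h y.1, 1), y.2)) = y := by
    intro y hyU hyO
    refine ⟨A.mem_domain_of_mem_hor (hs _ hyO).1 rfl, Prod.ext ?_ ?_⟩
    · change conjMk h _ (A.form _) = y.1
      rw [A.form_eq (hs _ hyO).1 rfl]
      refine Eq.trans ?_ ((conjTriv h hΦ).left_inv (x := y.1) hyU)
      have : (conjTriv h hΦ y.1).1 = conjProj h y.1 := by
        obtain ⟨q, w, hqw⟩ := exists_conjMk h y.1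
        rw [← hqw]; rfl
      rw [← this]
      rfl
    · change orbitMk G (_ • _) = y.2
      rw [orbitMk_smul, (hs _ hyO).2]
  have h0 := hev _ hU' hzO'
  -- The section built so far meets the orbit of `z`, possibly not at `z`; translating it by the
  -- constant `g` makes it pass through `z`.
  obtain ⟨g, hg⟩ := A.exists_smul_eq_of_upsilon_eq h0.1 hz h0.2
  refine ⟨fun y => g • (Φ.invFun (conjProj h y.1, 1),
    (conjTriv h hΦ y.1).2 • s (Φ.invFun (conjProj h y.1, 1), y.2)), ?_, hg.symm, ?_⟩
  · exact (ContMDiffAt.comp (A.Upsilon z) (h.contMDiff_const_smul g).contMDiffAt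
      (contMDiffAt_fst.comp (A.Upsilon z) hσ)).prodMk
      (ContMDiffAt.comp (A.Upsilon z) (h.contMDiff_const_smul g).contMDiffAt
        (contMDiffAt_snd.comp (A.Upsilon z) hσ))
  · have hUo : ∀ᶠ y : ConjBundle h × OrbitSpace G Q in 𝓝 (A.Upsilon z), conjProj h y.1 ∈ U :=
      (hΦ.isOpen_base.preimage ((conjProj_continuous h).comp continuous_fst)).mem_nhds hU'
    have hOo : ∀ᶠ y : ConjBundle h × OrbitSpace G Q in 𝓝 (A.Upsilon z),
        (Φ.invFun (conjProj h y.1, 1), y.2) ∈ O :=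
      (hp.continuousAt.prodMk continuousAt_snd) (hO.mem_nhds hzO')
    filter_upwards [hUo, hOo] with y hyU hyO
    have := hev y hyU hyO
    exact ⟨A.smul_mem_domain g this.1, (A.upsilon_smul g this.1).trans this.2⟩

theorem isOpen_image_upsilon : IsOpen (A.Upsilon '' A.domain) := by
  refine isOpen_iff_mem_nhds.2 ?_
  rintro _ ⟨z, hz, rfl⟩
  obtain ⟨σ, -, -, hσ⟩ := A.exists_local_section hz
  filter_upwards [hσ] with y hy
  exact ⟨σ y, hy⟩

/-- Near a point of its domain, the first component is a smooth function of `Υ` and the second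
component. -/
theorem exists_fst_eq_of_upsilon {z : Q × Q} (hz : z ∈ A.domain) :
    ∃ F : (ConjBundle h × OrbitSpace G Q) × Q → Q,
      ContMDiffAt (((𝓘(ℝ, EB).prod 𝓘(ℝ, EG)).prod 𝓘(ℝ, EB)).prod 𝓘(ℝ, EQ)) 𝓘(ℝ, EQ) ∞ F
        (A.Upsilon z, z.2) ∧
      ∀ᶠ y in 𝓝 z, F (A.Upsilon y, y.2) = y.1 := by
  obtain ⟨σ, hσs, hσz, hσ⟩ := A.exists_local_section hz
  obtain ⟨U, Φ, hU, hΦ⟩ := h.exists_trivialization (orbitMk G z.2)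
  have hσ' : ContMDiffAt (((𝓘(ℝ, EB).prod 𝓘(ℝ, EG)).prod 𝓘(ℝ, EB)).prod 𝓘(ℝ, EQ))
      (𝓘(ℝ, EQ).prod 𝓘(ℝ, EQ)) ∞
      (fun p : (ConjBundle h × OrbitSpace G Q) × Q => σ p.1) (A.Upsilon z, z.2) :=
    ContMDiffAt.comp (A.Upsilon z, z.2) hσs contMDiffAt_fst
  have h1 : ContMDiffAt (((𝓘(ℝ, EB).prod 𝓘(ℝ, EG)).prod 𝓘(ℝ, EB)).prod 𝓘(ℝ, EQ)) 𝓘(ℝ, EG) ∞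
      (fun p : (ConjBundle h × OrbitSpace G Q) × Q => (Φ (σ p.1).2).2) (A.Upsilon z, z.2) :=
    ContMDiffAt.comp (g := fun q => (Φ q).2) (A.Upsilon z, z.2)
      (hΦ.contMDiffAt_coord (by
        change orbitMk G (σ (A.Upsilon z)).2 ∈ U
        rw [hσz]; exact hU))
      (contMDiffAt_snd.comp (A.Upsilon z, z.2) hσ')
  have h2 : ContMDiffAt (((𝓘(ℝ, EB).prod 𝓘(ℝ, EG)).prod 𝓘(ℝ, EB)).prod 𝓘(ℝ, EQ)) 𝓘(ℝ, EG) ∞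
      (fun p : (ConjBundle h × OrbitSpace G Q) × Q => (Φ p.2).2) (A.Upsilon z, z.2) :=
    ContMDiffAt.comp (g := fun q => (Φ q).2) (A.Upsilon z, z.2)
      (hΦ.contMDiffAt_coord hU) contMDiffAt_snd
  -- The points `y` and `σ(Υ(y))` differ by one group element. It is read off from the
  -- `G`-coordinates of their second points and then applied to the first point of `σ(Υ(y))`.
  refine ⟨fun p => ((Φ p.2).2 * (Φ (σ p.1).2).2⁻¹) • (σ p.1).1,
    ContMDiffAt.comp (A.Upsilon z, z.2) h.smooth_action.contMDiff_smul.contMDiffAt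
      ((h2.mul h1.inv).prodMk (contMDiffAt_fst.comp (A.Upsilon z, z.2) hσ')), ?_⟩
  filter_upwards [(A.contMDiffAt_upsilon hz).continuousAt.eventually hσ,
    A.isOpen_domain.mem_nhds hz,
    (hΦ.isOpen_base.preimage (h.contMDiff_orbitMk.continuous.comp continuous_snd)).mem_nhds hU]
    with y hy hyd hyU
  obtain ⟨g, hg⟩ := A.exists_smul_eq_of_upsilon_eq hy.1 hyd hy.2
  have h3 : orbitMk G y.2 = orbitMk G (σ (A.Upsilon y)).2 := by
    conv_lhs => rw [hg]
    exact orbitMk_smul g _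
  have h4 := hΦ.mul_inv_smul hyU h3
  have h5 : y.2 = g • (σ (A.Upsilon y)).2 := congrArg Prod.snd hg
  have h6 := h.smul_cancel (h4.trans h5)
  change ((Φ y.2).2 * (Φ (σ (A.Upsilon y)).2).2⁻¹) • (σ (A.Upsilon y)).1 = y.1
  rw [h6]
  exact (congrArg Prod.fst hg).symm

end Smooth

end DiscreteConnection

/-! ### Tangent vectors to products and partial derivatives. -/

section Tangent

variable {V : Type*} [NormedAddCommGroup V] [NormedSpace ℝ V]
  {H : Type*} [TopologicalSpace H] {I : ModelWithCorners ℝ V H}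
  {X : Type*} [TopologicalSpace X] [ChartedSpace H X]
  {V' : Type*} [NormedAddCommGroup V'] [NormedSpace ℝ V']
  {H' : Type*} [TopologicalSpace H'] {J : ModelWithCorners ℝ V' H'}
  {Y : Type*} [TopologicalSpace Y] [ChartedSpace H' Y]
  {V'' : Type*} [NormedAddCommGroup V''] [NormedSpace ℝ V'']
  {H'' : Type*} [TopologicalSpace H''] {K : ModelWithCorners ℝ V'' H''}
  {Z : Type*} [TopologicalSpace Z] [ChartedSpace H'' Z]

/-- Points of the tangent bundle agree when their base points and, in the model space, their
vectors agree. -/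
theorem tangentBundle_mk_eq_mk_iff {x y : X} {v : TangentSpace I x} {w : TangentSpace I y} :
    (⟨x, v⟩ : TangentBundle I X) = ⟨y, w⟩ ↔ x = y ∧ @Eq V v w := by
  constructor
  · intro hvw
    cases hvw
    exact ⟨rfl, rfl⟩
  · rintro ⟨rfl, hvw⟩
    exact congrArg (Bundle.TotalSpace.mk x) hvw

theorem tangent_ext {z : X × Y} {v w : TangentSpace (I.prod J) z} (h₁ : tfst v = tfst w)
    (h₂ : tsnd v = tsnd w) : v = w :=
  Prod.ext (α := V) (β := V') h₁ h₂

theorem tpair_add {z : X × Y} (a a' : TangentSpace I z.1) (b b' : TangentSpace J z.2) :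
    tpair (a + a') (b + b') = tpair a b + tpair a' b' := rfl

theorem tpair_smul {z : X × Y} (c : ℝ) (a : TangentSpace I z.1) (b : TangentSpace J z.2) :
    tpair (c • a) (c • b) = c • tpair a b := rfl

theorem tfst_add {z : X × Y} (v w : TangentSpace (I.prod J) z) :
    tfst (v + w) = tfst v + tfst w := rfl

theorem tfst_smul {z : X × Y} (c : ℝ) (v : TangentSpace (I.prod J) z) :
    tfst (c • v) = c • tfst v := rfl

theorem tfst_mfderiv {F : Z → X × Y} {z : Z} (hF : MDifferentiableAt K (I.prod J) F z)
    (v : TangentSpace K z) :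
    tfst (mfderiv K (I.prod J) F z v) = mfderiv K I (fun z => (F z).1) z v := by
  have h1 := mfderiv_comp_apply (g := (Prod.fst : X × Y → X)) (I'' := I) z
    mdifferentiableAt_fst hF v
  rw [mfderiv_fst] at h1
  exact h1.symm

theorem tsnd_mfderiv {F : Z → X × Y} {z : Z} (hF : MDifferentiableAt K (I.prod J) F z)
    (v : TangentSpace K z) :
    tsnd (mfderiv K (I.prod J) F z v) = mfderiv K J (fun z => (F z).2) z v := by
  have h1 := mfderiv_comp_apply (g := (Prod.snd : X × Y → Y)) (I'' := J) z
    mdifferentiableAt_snd hF v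
  rw [mfderiv_snd] at h1
  exact h1.symm

/-- The partial derivative in the second variable. -/
theorem mfderiv_tpair_zero_left {F : X × Y → Z} {z : X × Y}
    (hF : MDifferentiableAt (I.prod J) K F z) (b : TangentSpace J z.2) :
    mfderiv (I.prod J) K F z (tpair 0 b) = mfderiv J K (fun y => F (z.1, y)) z.2 b := by
  have h1 := mfderiv_comp_apply (f := fun y : Y => (z.1, y)) (g := F) (I' := I.prod J) (I := J)
    (I'' := K) z.2 hF (mdifferentiableAt_const.prodMk mdifferentiableAt_id) b
  rw [mfderiv_prod_right] at h1
  exact h1.symm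

end Tangent

/-! ### The differential of `Υ`. -/

namespace DiscreteConnection

variable {EG EQ EB : Type*}
  [NormedAddCommGroup EG] [NormedSpace ℝ EG] [NormedAddCommGroup EQ] [NormedSpace ℝ EQ]
  [NormedAddCommGroup EB] [NormedSpace ℝ EB]
  {G Q : Type*} [Group G] [TopologicalSpace G] [ChartedSpace EG G] [LieGroup 𝓘(ℝ, EG) ∞ G]
  [TopologicalSpace Q] [ChartedSpace EQ Q] [MulAction G Q]
  [ChartedSpace EB (OrbitSpace G Q)]
  {h : IsPrincipalBundle EG EQ EB G Q} (A : DiscreteConnection h)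

theorem dUpsilon_add (z : Q × Q) (a a' : TangentSpace 𝓘(ℝ, EQ) z.1)
    (b b' : TangentSpace 𝓘(ℝ, EQ) z.2) :
    A.dUpsilon z (a + a') (b + b') = A.dUpsilon z a b + A.dUpsilon z a' b' := by
  rw [dUpsilon, tpair_add, map_add]; rfl

theorem dUpsilon_smul (z : Q × Q) (c : ℝ) (a : TangentSpace 𝓘(ℝ, EQ) z.1)
    (b : TangentSpace 𝓘(ℝ, EQ) z.2) :
    A.dUpsilon z (c • a) (c • b) = c • A.dUpsilon z a b := by
  rw [dUpsilon, tpair_smul, map_smul]; rfl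

/-- The linear map `v ↦ w`, where `dΥ(z)(v, 0) = (w, 0)`. -/
noncomputable def dUpsilonFst (z : Q × Q) :
    TangentSpace 𝓘(ℝ, EQ) z.1 →ₗ[ℝ] TangentSpace (𝓘(ℝ, EB).prod 𝓘(ℝ, EG)) (A.Upsilon z).1 where
  toFun v := tfst (A.dUpsilon z v 0)
  map_add' v w := by
    rw [← tfst_add, ← dUpsilon_add, add_zero]
  map_smul' c v := by
    rw [RingHom.id_apply, ← tfst_smul, ← dUpsilon_smul, smul_zero]

variable [IsManifold 𝓘(ℝ, EB) ∞ (OrbitSpace G Q)]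

theorem mdifferentiableAt_upsilon {z : Q × Q} (hz : z ∈ A.domain) :
    MDifferentiableAt (𝓘(ℝ, EQ).prod 𝓘(ℝ, EQ)) ((𝓘(ℝ, EB).prod 𝓘(ℝ, EG)).prod 𝓘(ℝ, EB))
      A.Upsilon z :=
  (A.contMDiffAt_upsilon hz).mdifferentiableAt (by simp)

theorem tsnd_dUpsilon {z : Q × Q} (hz : z ∈ A.domain) (a : TangentSpace 𝓘(ℝ, EQ) z.1)
    (b : TangentSpace 𝓘(ℝ, EQ) z.2) :
    tsnd (A.dUpsilon z a b) = mfderiv 𝓘(ℝ, EQ) 𝓘(ℝ, EB) (orbitMk G) z.2 b := by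
  have h1 := tsnd_mfderiv (A.mdifferentiableAt_upsilon hz) (tpair a b)
  have h2 := mfderiv_comp_apply (f := (Prod.snd : Q × Q → Q)) (I := 𝓘(ℝ, EQ).prod 𝓘(ℝ, EQ))
    (I' := 𝓘(ℝ, EQ)) (I'' := 𝓘(ℝ, EB)) (g := (orbitMk G : Q → OrbitSpace G Q)) z
    (h.contMDiff_orbitMk.contMDiffAt.mdifferentiableAt (by simp)) mdifferentiableAt_snd
    (tpair a b)
  rw [mfderiv_snd] at h2
  exact h1.trans h2

theorem dUpsilon_zero_right {z : Q × Q} (hz : z ∈ A.domain) (v : TangentSpace 𝓘(ℝ, EQ) z.1) :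
    A.dUpsilon z v 0 = tpair (A.dUpsilonFst z v) 0 :=
  tangent_ext rfl ((A.tsnd_dUpsilon hz v 0).trans (map_zero _))

theorem dUpsilon_zero_right_eq_iff {z : Q × Q} (hz : z ∈ A.domain)
    (v : TangentSpace 𝓘(ℝ, EQ) z.1)
    (w : TangentSpace (𝓘(ℝ, EB).prod 𝓘(ℝ, EG)) (A.Upsilon z).1) :
    A.dUpsilon z v 0 = tpair w 0 ↔ A.dUpsilonFst z v = w := by
  rw [A.dUpsilon_zero_right hz]
  exact ⟨fun hw => congrArg tfst hw, fun hw => by rw [hw]⟩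

theorem tfst_dUpsilon_zero_left {q₀ q₁ : Q} (hz : (q₀, q₁) ∈ A.domain)
    (b : TangentSpace 𝓘(ℝ, EQ) q₁) :
    tfst (A.dUpsilon (q₀, q₁) 0 b) = A.dUpsilon₂ q₀ q₁ b := by
  have hd := A.mdifferentiableAt_upsilon hz
  have h1 := tfst_mfderiv hd (tpair 0 b)
  exact h1.trans (mfderiv_tpair_zero_left (F := fun z => (A.Upsilon z).1)
    (mdifferentiableAt_fst.comp _ hd) b)

/-- This splitting is the source of the formula `δv_k = w_k + 𝒫̌(w_{k+1})`. -/
theorem tfst_dUpsilon {q₀ q₁ : Q} (hz : (q₀, q₁) ∈ A.domain) (a : TangentSpace 𝓘(ℝ, EQ) q₀)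
    (b : TangentSpace 𝓘(ℝ, EQ) q₁) :
    tfst (A.dUpsilon (q₀, q₁) a b) = A.dUpsilonFst (q₀, q₁) a + A.dUpsilon₂ q₀ q₁ b := by
  rw [← A.tfst_dUpsilon_zero_left hz]
  change _ = tfst (A.dUpsilon (q₀, q₁) a 0) + _
  rw [← tfst_add, ← dUpsilon_add]
  simp

/-- `dφ ∘ p₁ ∘ dΥ = dπ ∘ p₁`. -/
theorem mfderiv_conjProj_tfst_dUpsilon {z : Q × Q} (hz : z ∈ A.domain)
    (a : TangentSpace 𝓘(ℝ, EQ) z.1) (b : TangentSpace 𝓘(ℝ, EQ) z.2) :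
    mfderiv (𝓘(ℝ, EB).prod 𝓘(ℝ, EG)) 𝓘(ℝ, EB) (conjProj h) (A.Upsilon z).1
      (tfst (A.dUpsilon z a b)) =
    mfderiv 𝓘(ℝ, EQ) 𝓘(ℝ, EB) (orbitMk G) z.1 a := by
  have hd := A.mdifferentiableAt_upsilon hz
  have h1 := tfst_mfderiv hd (tpair a b)
  have h2 := mfderiv_comp_apply (f := fun z => (A.Upsilon z).1) (g := conjProj h)
    (I'' := 𝓘(ℝ, EB)) z
    ((contMDiff_conjProj h).contMDiffAt.mdifferentiableAt (by simp))
    (mdifferentiableAt_fst.comp z hd) (tpair a b)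
  have h3 := mfderiv_comp_apply (f := (Prod.fst : Q × Q → Q)) (I := 𝓘(ℝ, EQ).prod 𝓘(ℝ, EQ))
    (I' := 𝓘(ℝ, EQ)) (I'' := 𝓘(ℝ, EB)) (g := (orbitMk G : Q → OrbitSpace G Q)) z
    (h.contMDiff_orbitMk.contMDiffAt.mdifferentiableAt (by simp)) mdifferentiableAt_fst
    (tpair a b)
  rw [mfderiv_fst] at h3
  exact ((congrArg _ h1).trans h2.symm).trans h3

theorem mfderiv_conjProj_dUpsilonFst {z : Q × Q} (hz : z ∈ A.domain)
    (a : TangentSpace 𝓘(ℝ, EQ) z.1) :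
    mfderiv (𝓘(ℝ, EB).prod 𝓘(ℝ, EG)) 𝓘(ℝ, EB) (conjProj h) (A.Upsilon z).1
      (A.dUpsilonFst z a) =
    mfderiv 𝓘(ℝ, EQ) 𝓘(ℝ, EB) (orbitMk G) z.1 a :=
  A.mfderiv_conjProj_tfst_dUpsilon hz a 0

/-- Moving only `q₁` leaves the base point `π(q₀)` of the first component fixed. This is why the
chaining map takes values in `ker dφ`. -/
theorem mfderiv_conjProj_dUpsilon₂ {q₀ q₁ : Q} (hz : (q₀, q₁) ∈ A.domain)
    (b : TangentSpace 𝓘(ℝ, EQ) q₁) :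
    mfderiv (𝓘(ℝ, EB).prod 𝓘(ℝ, EG)) 𝓘(ℝ, EB) (conjProj h) (A.Upsilon (q₀, q₁)).1
      (A.dUpsilon₂ q₀ q₁ b) = 0 := by
  rw [← A.tfst_dUpsilon_zero_left hz]
  exact (A.mfderiv_conjProj_tfst_dUpsilon hz 0 b).trans (map_zero _)

/-- `Υ(·, q₁)` is an immersion. -/
theorem dUpsilonFst_injective {z : Q × Q} (hz : z ∈ A.domain) :
    Function.Injective (A.dUpsilonFst z) := by
  refine (injective_iff_map_eq_zero _).2 fun v hv => ?_
  -- Differentiating `F(Υ(y), y.2) = y.1` along `(v, 0)` gives `v` on the right, and `0` on the left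
  -- because both arguments of `F` have zero derivative.
  obtain ⟨F, hF, hFz⟩ := A.exists_fst_eq_of_upsilon hz
  have hd := A.mdifferentiableAt_upsilon hz
  have hz0 : A.dUpsilon z v 0 = 0 := by
    rw [A.dUpsilon_zero_right hz, hv]; rfl
  have hpair : MDifferentiableAt (𝓘(ℝ, EQ).prod 𝓘(ℝ, EQ))
      (((𝓘(ℝ, EB).prod 𝓘(ℝ, EG)).prod 𝓘(ℝ, EB)).prod 𝓘(ℝ, EQ))
      (fun y : Q × Q => (A.Upsilon y, y.2)) z := hd.prodMk mdifferentiableAt_snd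
  have h1 := mfderiv_comp_apply (f := fun y : Q × Q => (A.Upsilon y, y.2)) (g := F)
    (I'' := 𝓘(ℝ, EQ)) z (hF.mdifferentiableAt (by simp)) hpair (tpair v 0)
  have h2 : mfderiv (𝓘(ℝ, EQ).prod 𝓘(ℝ, EQ))
      (((𝓘(ℝ, EB).prod 𝓘(ℝ, EG)).prod 𝓘(ℝ, EB)).prod 𝓘(ℝ, EQ))
      (fun y : Q × Q => (A.Upsilon y, y.2)) z (tpair v 0) = 0 := by
    refine tangent_ext ((tfst_mfderiv hpair _).trans hz0) ((tsnd_mfderiv hpair _).trans ?_)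
    change mfderiv (𝓘(ℝ, EQ).prod 𝓘(ℝ, EQ)) 𝓘(ℝ, EQ) (Prod.snd : Q × Q → Q) z (tpair v 0) = 0
    rw [mfderiv_snd]
    rfl
  rw [h2, map_zero] at h1
  have h3 : (F ∘ fun y : Q × Q => (A.Upsilon y, y.2)) =ᶠ[𝓝 z] Prod.fst := hFz
  have h4 := h3.mfderiv_eq (I := 𝓘(ℝ, EQ).prod 𝓘(ℝ, EQ)) (I' := 𝓘(ℝ, EQ))
  rw [mfderiv_fst] at h4
  exact (DFunLike.congr_fun h4 (tpair v 0)).symm.trans h1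

/-- The infinitesimal form of the invariance of `Υ` under the diagonal action. -/
theorem dUpsilon_smul_action (g : G) {z : Q × Q} (hz : z ∈ A.domain)
    (a : TangentSpace 𝓘(ℝ, EQ) z.1) (b : TangentSpace 𝓘(ℝ, EQ) z.2) :
    -- The base points `Υ(g • z)` and `Υ(z)` are equal only propositionally, so the vectors are
    -- compared in the common model space.
    @Eq ((EB × EG) × EB)
      (A.dUpsilon (g • z) (mfderiv 𝓘(ℝ, EQ) 𝓘(ℝ, EQ) (fun q : Q => g • q) z.1 a)
        (mfderiv 𝓘(ℝ, EQ) 𝓘(ℝ, EQ) (fun q : Q => g • q) z.2 b))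
      (A.dUpsilon z a b) := by
  have hg : ∀ q : Q, MDifferentiableAt 𝓘(ℝ, EQ) 𝓘(ℝ, EQ) (fun q : Q => g • q) q := fun q =>
    (h.contMDiff_const_smul g).contMDiffAt.mdifferentiableAt (by simp)
  have h1 := mfderiv_comp_apply
    (f := Prod.map (fun q : Q => g • q) (fun q : Q => g • q)) (g := A.Upsilon)
    (I := 𝓘(ℝ, EQ).prod 𝓘(ℝ, EQ))
    (I'' := (𝓘(ℝ, EB).prod 𝓘(ℝ, EG)).prod 𝓘(ℝ, EB)) z
    (A.mdifferentiableAt_upsilon (A.smul_mem_domain g hz)) ((hg z.1).prodMap (hg z.2))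
    (tpair a b)
  rw [mfderiv_prodMap (hg z.1) (hg z.2)] at h1
  have h2 : (A.Upsilon ∘ Prod.map (fun q : Q => g • q) (fun q : Q => g • q)) =ᶠ[𝓝 z]
      A.Upsilon := by
    filter_upwards [A.isOpen_domain.mem_nhds hz] with y hy
    exact A.upsilon_smul g hy
  have h3 := h2.mfderiv_eq (I := 𝓘(ℝ, EQ).prod 𝓘(ℝ, EQ))
    (I' := (𝓘(ℝ, EB).prod 𝓘(ℝ, EG)).prod 𝓘(ℝ, EB))
  exact h1.symm.trans (DFunLike.congr_fun h3 (tpair a b))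

end DiscreteConnection

/-! ### The reduced data are well defined; lifting of reduced paths. -/

namespace DiscreteConnection

variable {EG EQ EB : Type*}
  [NormedAddCommGroup EG] [NormedSpace ℝ EG] [NormedAddCommGroup EQ] [NormedSpace ℝ EQ]
  [NormedAddCommGroup EB] [NormedSpace ℝ EB]
  {G Q : Type*} [Group G] [TopologicalSpace G] [ChartedSpace EG G]
  [TopologicalSpace Q] [ChartedSpace EQ Q] [IsManifold 𝓘(ℝ, EQ) ∞ Q] [MulAction G Q]
  [ChartedSpace EB (OrbitSpace G Q)]
  {h : IsPrincipalBundle EG EQ EB G Q} (A : DiscreteConnection h) {S : DNHMS EQ Q}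

theorem reducedL_upsilon (hS : S.IsInvariant G) {z : Q × Q} (hz : z ∈ A.domain) :
    A.reducedL S (A.Upsilon z) = S.L z := by
  have hex : ∃ z' ∈ A.domain, A.Upsilon z' = A.Upsilon z := ⟨z, hz, rfl⟩
  obtain ⟨g, hg⟩ := A.exists_smul_eq_of_upsilon_eq hex.choose_spec.1 hz hex.choose_spec.2
  rw [reducedL, dif_pos hex]
  conv_rhs => rw [hg]
  exact (hS.L_inv g _ _).symm

variable [LieGroup 𝓘(ℝ, EG) ∞ G]

/-- Both sides of the matching condition are `π(q_{k+1})` by definition. -/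
theorem isPath_reducedPath {N : ℕ} {q : Fin (N + 1) → Q}
    (hq : ∀ k : Fin N, (q k.castSucc, q k.succ) ∈ A.domain) :
    (A.reducedSystem S).IsPath (A.reducedPath q) :=
  ⟨fun k => ⟨_, hq k, rfl⟩, fun _ _ => rfl⟩

/-- Every discrete path of the reduced system with at least one step is the image of a discrete
path in `Q`. -/
theorem exists_lift_of_isPath {N : ℕ} {x : Fin (N + 1) → ConjBundle h × OrbitSpace G Q}
    (hx : (A.reducedSystem S).IsPath x) :
    ∃ q : Fin (N + 2) → Q, (∀ k : Fin (N + 1), (q k.castSucc, q k.succ) ∈ A.domain) ∧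
      A.reducedPath q = x := by
  induction N with
  | zero =>
    obtain ⟨z, hz, hzx⟩ := hx.1 0
    refine ⟨![z.1, z.2], fun k => ?_, funext fun k => ?_⟩
    · obtain rfl : k = 0 := Fin.ext (by omega)
      exact hz
    · obtain rfl : k = 0 := Fin.ext (by omega)
      exact hzx
  | succ N ih =>
    obtain ⟨q, hq, hqx⟩ := ih (x := fun k => x k.succ)
      ⟨fun k => hx.1 k.succ, fun k hk => hx.2 (k + 1) (Nat.succ_lt_succ hk)⟩
    obtain ⟨z, hz, hzx⟩ := hx.1 0
    have h1 : orbitMk G (q 0) = orbitMk G z.2 := by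
      have h2 : (x 0).2 = conjProj h (x (Fin.succ 0)).1 := hx.2 0 (by omega)
      rw [← hzx, ← show A.reducedPath q 0 = x (Fin.succ 0) from congrFun hqx 0] at h2
      exact h2.symm
    -- The matching condition only puts `z.2` in the orbit of the first point of the lifted tail.
    -- Translating the first pair by `g` joins the two and leaves its image under `Υ` unchanged.
    obtain ⟨g, hg⟩ := orbitMk_eq_iff.1 h1
    have h0 : ((g • z).1, q 0) = g • z := Prod.ext rfl hg
    refine ⟨Fin.cons (g • z).1 q, fun k => ?_, funext fun k => ?_⟩
    · induction k using Fin.cases with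
      | zero =>
        change ((g • z).1, q 0) ∈ A.domain
        rw [h0]
        exact A.smul_mem_domain g hz
      | succ k => exact hq k
    · induction k using Fin.cases with
      | zero =>
        change A.Upsilon ((g • z).1, q 0) = x 0
        rw [h0, A.upsilon_smul g hz]
        exact hzx
      | succ k => exact congrFun hqx k

variable [IsManifold 𝓘(ℝ, EB) ∞ (OrbitSpace G Q)]

/-- Near `Υ(z)` the reduced Lagrangian is `S.L` composed with a smooth local section of `Υ`. -/
theorem contMDiffOn_reducedL (hS : S.IsInvariant G) :
    ContMDiffOn ((𝓘(ℝ, EB).prod 𝓘(ℝ, EG)).prod 𝓘(ℝ, EB)) 𝓘(ℝ, ℝ) ∞ (A.reducedL S)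
      (A.Upsilon '' A.domain) := by
  rintro _ ⟨z, hz, rfl⟩
  obtain ⟨σ, hσs, -, hσ⟩ := A.exists_local_section hz
  refine ContMDiffAt.contMDiffWithinAt
    ((S.L_smooth.contMDiffAt.comp (A.Upsilon z) hσs).congr_of_eventuallyEq ?_)
  filter_upwards [hσ] with y hy
  conv_lhs => rw [← hy.2]
  exact A.reducedL_upsilon hS hy.1

/-- Any other representative is a translate of `z`, and the invariance of `𝒟^{nh}` and of `dΥ` shows
that it contributes the same vectors. The generators of the span thus already form the subspace
coming from `z`. -/
theorem reducedD_upsilon (hS : S.IsInvariant G) {z : Q × Q} (hz : z ∈ A.domain) :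
    A.reducedD S (A.Upsilon z) = (S.D z.1).map (A.dUpsilonFst z) := by
  rw [reducedD, ← Submodule.span_eq ((S.D z.1).map (A.dUpsilonFst z))]
  congr 1
  ext w
  constructor
  · rintro ⟨z', hz', v, hv, hw⟩
    obtain ⟨h1, h2⟩ := tangentBundle_mk_eq_mk_iff.1 hw
    obtain ⟨g, rfl⟩ := A.exists_smul_eq_of_upsilon_eq hz' hz h1.symm
    refine ⟨_, hS.D_inv g _ v hv, ?_⟩
    refine (A.dUpsilon_zero_right_eq_iff hz _ w).1 ?_
    have h3 := A.dUpsilon_smul_action g hz' v 0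
    rw [map_zero] at h3
    exact h3.trans h2.symm
  · rintro ⟨v, hv, rfl⟩
    exact ⟨z, hz, v, hv, by rw [A.dUpsilon_zero_right hz]⟩

theorem mem_reducedD_upsilon (hS : S.IsInvariant G) {z : Q × Q} (hz : z ∈ A.domain)
    (w : TangentSpace (𝓘(ℝ, EB).prod 𝓘(ℝ, EG)) (A.Upsilon z).1) :
    w ∈ A.reducedD S (A.Upsilon z) ↔ ∃ v ∈ S.D z.1, A.dUpsilon z v 0 = tpair w 0 := by
  rw [A.reducedD_upsilon hS hz]
  simp only [A.dUpsilon_zero_right_eq_iff hz]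
  exact Iff.rfl

/-- `D₂(p₁ ∘ Υ)(q₀, q₁)` as a linear map to `ker dφ`. -/
noncomputable def dUpsilon₂Ker {q₀ q₁ : Q} (hz : (q₀, q₁) ∈ A.domain) :
    TangentSpace 𝓘(ℝ, EQ) q₁ →ₗ[ℝ] LinearMap.ker (mfderiv (𝓘(ℝ, EB).prod 𝓘(ℝ, EG)) 𝓘(ℝ, EB)
      (conjProj h) (A.Upsilon (q₀, q₁)).1).toLinearMap :=
  LinearMap.codRestrict _
    (mfderiv 𝓘(ℝ, EQ) (𝓘(ℝ, EB).prod 𝓘(ℝ, EG)) (fun q => (A.Upsilon (q₀, q)).1) q₁).toLinearMap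
    fun b => A.mfderiv_conjProj_dUpsilon₂ hz b

/-- Injectivity of `dΥ` on the vectors `(v, 0)` lets one recover `δq₁` from `w`; the map is this
inverse followed by `D₂(p₁ ∘ Υ)(q₀, q₁)`. -/
theorem exists_isReducedP (hS : S.IsInvariant G) {q₀ q₁ q₂ : Q} (hz : (q₀, q₁) ∈ A.domain)
    (hz' : (q₁, q₂) ∈ A.domain) :
    ∃ f, A.IsReducedP S (A.Upsilon (q₀, q₁)) (A.Upsilon (q₁, q₂)) f := by
  let e := (LinearEquiv.ofEq _ _ (A.reducedD_upsilon hS hz')).trans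
    (Submodule.equivMapOfInjective _ (A.dUpsilonFst_injective hz') (S.D q₁)).symm
  refine ⟨(A.dUpsilon₂Ker hz).comp ((S.D q₁).subtype.comp e.toLinearMap), ?_⟩
  intro p₀ p₁ p₂ hp hp' hx δ hδ w hw
  obtain ⟨hy, hw⟩ := tangentBundle_mk_eq_mk_iff.1 hw
  obtain ⟨g, hg⟩ := A.exists_smul_eq_of_upsilon_eq hp hz hx
  obtain ⟨g', hg'⟩ := A.exists_smul_eq_of_upsilon_eq hp' hz' hy.symm
  obtain rfl : q₀ = g • p₀ := congrArg Prod.fst hg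
  obtain rfl : q₁ = g • p₁ := congrArg Prod.snd hg
  -- The two pairs share their middle point, so by freeness a single group element translates the
  -- whole triple.
  obtain rfl : g = g' := h.smul_cancel (congrArg Prod.fst hg')
  obtain rfl : q₂ = g • p₂ := congrArg Prod.snd hg'
  set δ' := mfderiv 𝓘(ℝ, EQ) 𝓘(ℝ, EQ) (fun q : Q => g • q) p₁ δ with hδ'
  have hδS : δ' ∈ S.D (g • p₁) := hS.D_inv g p₁ δ hδ
  have h1 : A.dUpsilonFst (g • p₁, g • p₂) δ' = w := by
    refine (A.dUpsilon_zero_right_eq_iff hz' _ _).1 ?_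
    have h3 := A.dUpsilon_smul_action g hp' δ 0
    rw [map_zero] at h3
    exact h3.trans hw.symm
  have h2 : e w = ⟨δ', hδS⟩ := by
    rw [← LinearEquiv.eq_symm_apply]
    exact Subtype.ext h1.symm
  refine tangentBundle_mk_eq_mk_iff.2 ⟨congrArg Prod.fst hx.symm, ?_⟩
  have h3 := A.dUpsilon_smul_action g hp 0 δ
  rw [map_zero] at h3
  have h4 : @Eq (EB × EG) (A.dUpsilon₂ (g • p₀) (g • p₁) δ') (A.dUpsilon₂ p₀ p₁ δ) := by
    rw [← A.tfst_dUpsilon_zero_left hp δ, ← A.tfst_dUpsilon_zero_left hz δ']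
    exact congrArg (Prod.fst : (EB × EG) × EB → EB × EG) h3
  refine Eq.trans ?_ h4
  change A.dUpsilon₂ (g • p₀) (g • p₁) (e w : TangentSpace 𝓘(ℝ, EQ) (g • p₁)) = _
  rw [h2]

theorem isReducedP_reducedP (hS : S.IsInvariant G) {q₀ q₁ q₂ : Q} (hz : (q₀, q₁) ∈ A.domain)
    (hz' : (q₁, q₂) ∈ A.domain) :
    A.IsReducedP S (A.Upsilon (q₀, q₁)) (A.Upsilon (q₁, q₂))
      (A.reducedP S (A.Upsilon (q₀, q₁)) (A.Upsilon (q₁, q₂))) := by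
  have hex := A.exists_isReducedP hS hz hz'
  rw [reducedP, dif_pos hex]
  exact hex.choose_spec

theorem reducedP_apply (hS : S.IsInvariant G) {q₀ q₁ q₂ : Q} (hz : (q₀, q₁) ∈ A.domain)
    (hz' : (q₁, q₂) ∈ A.domain) {v : TangentSpace 𝓘(ℝ, EQ) q₁} (hv : v ∈ S.D q₁)
    (w : A.reducedD S (A.Upsilon (q₁, q₂)))
    (hw : A.dUpsilonFst (q₁, q₂) v = w) :
    (A.reducedP S (A.Upsilon (q₀, q₁)) (A.Upsilon (q₁, q₂)) w :
      TangentSpace (𝓘(ℝ, EB).prod 𝓘(ℝ, EG)) (A.Upsilon (q₀, q₁)).1) = A.dUpsilon₂ q₀ q₁ v := by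
  refine (tangentBundle_mk_eq_mk_iff.1 (A.isReducedP_reducedP hS hz hz' q₀ q₁ q₂ hz hz' rfl v hv w
    (by rw [(A.dUpsilon_zero_right_eq_iff hz' v w).2 hw]))).2

/-! ### Correspondence of variations and trajectories along a path. -/

section Paths

variable {N : ℕ} {q : Fin (N + 1) → Q}

theorem isNHVariation_reducedVariation (hS : S.IsInvariant G)
    (hq : ∀ k : Fin N, (q k.castSucc, q k.succ) ∈ A.domain)
    {δq : ∀ k, TangentSpace 𝓘(ℝ, EQ) (q k)} (hδ : S.IsFixedEndpointVariation q δq) :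
    (A.reducedSystem S).IsNHVariation (A.reducedPath q) (A.reducedVariation q δq) := by
  obtain ⟨h0, hN, hD⟩ := hδ
  refine ⟨fun k hk => ?_, fun k => ⟨A.dUpsilonFst (q k.castSucc, q k.succ) (δq k.castSucc), ?_⟩,
    ?_, ?_, ?_⟩
  · refine tangentBundle_mk_eq_mk_iff.2 ⟨rfl, ?_⟩
    exact (A.tsnd_dUpsilon (hq ⟨k, Nat.lt_of_succ_lt hk⟩) _ _).trans
      (A.mfderiv_conjProj_tfst_dUpsilon (hq ⟨k + 1, hk⟩) _ _).symm
  · change _ ∈ A.reducedD S (A.Upsilon _)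
    rw [A.reducedD_upsilon hS (hq k)]
    exact ⟨_, hD _, rfl⟩
  · intro k hk
    obtain ⟨N, rfl⟩ : ∃ M, N = M + 1 := ⟨N - 1, by have := k.2; omega⟩
    obtain rfl : k = 0 := Fin.ext hk
    refine Subtype.ext ?_
    change A.dUpsilonFst (q 0, q (Fin.succ 0)) (δq 0) = 0
    rw [h0, map_zero]
  · intro k hk
    have hlast : k.succ = Fin.last N := Fin.ext hk
    have hz : δq k.succ = 0 := by rw [hlast]; exact hN
    constructor
    · refine (A.tsnd_dUpsilon (hq k) _ _).trans ?_
      change mfderiv 𝓘(ℝ, EQ) 𝓘(ℝ, EB) (orbitMk G) (q k.succ) (δq k.succ) = 0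
      rw [hz, map_zero]
    -- Since `δq_N = 0`, the last step has no chaining term.
    · change tfst (A.dUpsilon _ (δq k.castSucc) (δq k.succ)) = tfst (A.dUpsilon _ _ 0)
      rw [hz]
  · intro k hk
    refine (A.tfst_dUpsilon (hq ⟨k, Nat.lt_of_succ_lt hk⟩) _ _).trans ?_
    congr 1
    exact (A.reducedP_apply hS (hq ⟨k, Nat.lt_of_succ_lt hk⟩) (hq ⟨k + 1, hk⟩)
      (hD (Fin.castSucc ⟨k + 1, hk⟩)) ⟨_, _⟩ rfl).symm

theorem exists_eq_reducedVariation (hS : S.IsInvariant G)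
    (hq : ∀ k : Fin N, (q k.castSucc, q k.succ) ∈ A.domain)
    {δ : ∀ k, TangentSpace ((𝓘(ℝ, EB).prod 𝓘(ℝ, EG)).prod 𝓘(ℝ, EB)) (A.reducedPath q k)}
    (hδ : (A.reducedSystem S).IsNHVariation (A.reducedPath q) δ) :
    ∃ δq : ∀ k, TangentSpace 𝓘(ℝ, EQ) (q k), S.IsFixedEndpointVariation q δq ∧
      ∀ k, δ k = A.reducedVariation q δq k := by
  obtain ⟨hvar, w, hw0, hwN, hw⟩ := hδ
  have hex : ∀ k : Fin N, ∃ v ∈ S.D (q k.castSucc),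
      A.dUpsilonFst (q k.castSucc, q k.succ) v = (w k).1 := by
    intro k
    have h1 : (w k : TangentSpace (𝓘(ℝ, EB).prod 𝓘(ℝ, EG)) (A.reducedPath q k).1) ∈
      A.reducedD S (A.Upsilon (q k.castSucc, q k.succ)) := (w k).2
    rw [A.reducedD_upsilon hS (hq k)] at h1
    exact h1
  choose v hvD hvw using hex
  -- For `k < N` the vector `δq_k` is the preimage of `w_k`; the value `0` at index `N` is the
  -- endpoint condition.
  let δq : ∀ k, TangentSpace 𝓘(ℝ, EQ) (q k) :=
    Fin.lastCases (motive := fun k => TangentSpace 𝓘(ℝ, EQ) (q k)) 0 v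
  have hδlast : δq (Fin.last N) = 0 := Fin.lastCases_last
  have hδcast : ∀ k : Fin N, δq k.castSucc = v k := fun k => Fin.lastCases_castSucc k
  refine ⟨δq, ⟨?_, hδlast, fun k => ?_⟩, fun k => ?_⟩
  -- For `N = 0` the initial point is also the last one; otherwise `w_0 = 0` and injectivity give
  -- `δq_0 = 0`.
  · obtain _ | N := N
    · exact hδlast
    · refine (hδcast 0).trans (A.dUpsilonFst_injective (hq 0) ?_)
      exact (hvw 0).trans ((congrArg Subtype.val (hw0 0 rfl)).trans (map_zero _).symm)
  · induction k using Fin.lastCases with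
    | last => rw [hδlast]; exact zero_mem _
    | cast k => rw [hδcast]; exact hvD k
  · by_cases hk : (k : ℕ) + 1 = N
    · have hz : δq k.succ = 0 := by
        have hlast : k.succ = Fin.last N := Fin.ext hk
        rw [hlast]; exact hδlast
      obtain ⟨h1, h2⟩ := hwN k hk
      rw [reducedVariation, hz, hδcast, A.dUpsilon_zero_right (hq k), hvw]
      exact tangent_ext h2 h1
    · obtain ⟨k, hkN⟩ := k
      have hk' : k + 1 < N := lt_of_le_of_ne hkN hk
      have hs : δq (Fin.succ ⟨k, hkN⟩) = v ⟨k + 1, hk'⟩ := hδcast ⟨k + 1, hk'⟩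
      have hP := A.reducedP_apply hS (hq ⟨k, hkN⟩) (hq ⟨k + 1, hk'⟩) (hvD ⟨k + 1, hk'⟩)
        (w ⟨k + 1, hk'⟩) (hvw ⟨k + 1, hk'⟩)
      refine tangent_ext ?_ ?_
      · refine (hw k hk').trans (Eq.trans ?_ (A.tfst_dUpsilon (hq ⟨k, hkN⟩) _ _).symm)
        rw [hδcast, hvw, hs]
        exact congrArg _ hP
      · refine Eq.trans ?_ (A.tsnd_dUpsilon (hq ⟨k, hkN⟩) _ _).symm
        change _ = mfderiv 𝓘(ℝ, EQ) 𝓘(ℝ, EB) (orbitMk G) (q (Fin.succ ⟨k, hkN⟩))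
          (δq (Fin.succ ⟨k, hkN⟩))
        rw [hs]
        refine (tangentBundle_mk_eq_mk_iff.1 (hvar k hk')).2.trans
          (Eq.trans ?_ (A.mfderiv_conjProj_dUpsilonFst (hq ⟨k + 1, hk'⟩) _))
        -- Under `dφ` the vector `δv_{k+1}` may be replaced by `w_{k+1}`: they are equal in the last
        -- step and otherwise differ by a chaining term in `ker dφ`.
        have h1 : mfderiv (𝓘(ℝ, EB).prod 𝓘(ℝ, EG)) 𝓘(ℝ, EB) (conjProj h)
            (A.reducedPath q ⟨k + 1, hk'⟩).1 (tfst (δ ⟨k + 1, hk'⟩)) =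
            mfderiv (𝓘(ℝ, EB).prod 𝓘(ℝ, EG)) 𝓘(ℝ, EB) (conjProj h)
            (A.reducedPath q ⟨k + 1, hk'⟩).1
            (w ⟨k + 1, hk'⟩ : TangentSpace (𝓘(ℝ, EB).prod 𝓘(ℝ, EG))
              (A.reducedPath q ⟨k + 1, hk'⟩).1) := by
          by_cases hk2 : k + 1 + 1 = N
          · rw [(hwN ⟨k + 1, hk'⟩ hk2).2]
          · have hk2' : k + 1 + 1 < N := lt_of_le_of_ne hk' hk2
            rw [hw (k + 1) hk2', map_add]
            refine add_eq_left.2 ?_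
            exact ((A.reducedSystem S).P _ _ (w ⟨k + 1 + 1, hk2'⟩)).2
        exact h1.trans (congrArg _ (hvw ⟨k + 1, hk'⟩).symm)

theorem isTrajectory_reducedPath_iff (hS : S.IsInvariant G)
    (hq : ∀ k : Fin N, (q k.castSucc, q k.succ) ∈ A.domain) :
    (A.reducedSystem S).IsTrajectory (A.reducedPath q) ↔ A.ReducedPrinciple S q := by
  refine ⟨fun ⟨_, h2, h3⟩ => ⟨h2, fun δq hδq =>
    h3 _ (A.isNHVariation_reducedVariation hS hq hδq)⟩,
    fun ⟨h2, h3⟩ => ⟨A.isPath_reducedPath hq, h2, fun δ hδ => ?_⟩⟩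
  obtain ⟨δq, hδq, hδ'⟩ := A.exists_eq_reducedVariation hS hq hδ
  obtain rfl : δ = A.reducedVariation q δq := funext hδ'
  exact h3 δq hδq

end Paths

end DiscreteConnection

end DiscreteReduction

theorem mainTheorem10
    {EG EQ EB : Type*}
    [NormedAddCommGroup EG] [NormedSpace ℝ EG] [FiniteDimensional ℝ EG]
    [NormedAddCommGroup EQ] [NormedSpace ℝ EQ] [FiniteDimensional ℝ EQ]
    [NormedAddCommGroup EB] [NormedSpace ℝ EB] [FiniteDimensional ℝ EB]
    {G Q : Type*} [Group G] [TopologicalSpace G] [ChartedSpace EG G] [LieGroup 𝓘(ℝ, EG) ∞ G]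
    [TopologicalSpace Q] [ChartedSpace EQ Q] [IsManifold 𝓘(ℝ, EQ) ∞ Q] [MulAction G Q]
    [ChartedSpace EB (OrbitSpace G Q)] [IsManifold 𝓘(ℝ, EB) ∞ (OrbitSpace G Q)]
    (h : IsPrincipalBundle EG EQ EB G Q) (A : DiscreteConnection h)
    (S : DNHMS EQ Q) (hS : S.IsInvariant G) :
    -- the data of the reduced system are well defined, and its Lagrangian is smooth
    IsOpen (A.reducedSystem S).dom ∧
    ContMDiffOn ((𝓘(ℝ, EB).prod 𝓘(ℝ, EG)).prod 𝓘(ℝ, EB)) 𝓘(ℝ, ℝ) ∞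
      (A.reducedSystem S).L (A.reducedSystem S).dom ∧
    (∀ z ∈ A.domain, (A.reducedSystem S).L (A.Upsilon z) = S.L z) ∧
    (∀ z ∈ A.domain, ∀ w, w ∈ (A.reducedSystem S).D (A.Upsilon z) ↔
      ∃ v ∈ S.D z.1, A.dUpsilon z v 0 = tpair w 0) ∧
    (∀ q₀ q₁ q₂ : Q, (q₀, q₁) ∈ A.domain → (q₁, q₂) ∈ A.domain →
      A.IsReducedP S (A.Upsilon (q₀, q₁)) (A.Upsilon (q₁, q₂))
        ((A.reducedSystem S).P (A.Upsilon (q₀, q₁)) (A.Upsilon (q₁, q₂)))) ∧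
    -- the correspondence of variations and trajectories
    ∀ N : ℕ, 1 ≤ N →
      (∀ q : Fin (N + 1) → Q, (∀ k : Fin N, (q k.castSucc, q k.succ) ∈ A.domain) →
        (A.reducedSystem S).IsPath (A.reducedPath q) ∧
        (∀ δq : ∀ k, TangentSpace 𝓘(ℝ, EQ) (q k), S.IsFixedEndpointVariation q δq →
          (A.reducedSystem S).IsNHVariation (A.reducedPath q) (A.reducedVariation q δq)) ∧
        (∀ δ, (A.reducedSystem S).IsNHVariation (A.reducedPath q) δ →
          ∃ δq : ∀ k, TangentSpace 𝓘(ℝ, EQ) (q k), S.IsFixedEndpointVariation q δq ∧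
            ∀ k, δ k = A.reducedVariation q δq k) ∧
        ((A.reducedSystem S).IsTrajectory (A.reducedPath q) ↔ A.ReducedPrinciple S q)) ∧
      ∀ x : Fin N → ConjBundle h × OrbitSpace G Q,
        (A.reducedSystem S).IsTrajectory x ↔ A.IsReducedTrajectory S x := by
  refine ⟨A.isOpen_image_upsilon, A.contMDiffOn_reducedL hS, fun z hz => A.reducedL_upsilon hS hz,
    fun z hz w => A.mem_reducedD_upsilon hS hz w,
    fun q₀ q₁ q₂ hz hz' => A.isReducedP_reducedP hS hz hz', fun N hN => ⟨fun q hq =>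
      ⟨A.isPath_reducedPath hq, fun δq hδ => A.isNHVariation_reducedVariation hS hq hδ,
        fun δ hδ => A.exists_eq_reducedVariation hS hq hδ,
        A.isTrajectory_reducedPath_iff hS hq⟩, fun x => ⟨fun hx => ?_, ?_⟩⟩⟩
  -- Here `1 ≤ N` matters: lifting an empty path would require a point of `Q`, which may be empty.
  · obtain ⟨N, rfl⟩ : ∃ M, N = M + 1 := ⟨N - 1, by omega⟩
    obtain ⟨q, hq, rfl⟩ := A.exists_lift_of_isPath hx.1
    exact ⟨q, hq, rfl, (A.isTrajectory_reducedPath_iff hS hq).1 hx⟩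
  · rintro ⟨q, hq, rfl, hP⟩
    exact (A.isTrajectory_reducedPath_iff hS hq).2 hP
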